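/- Let $G$ be a connected real Lie group with Lie algebra $\mathfrak g$, and let $\mathbf F\in \mathbf Z^2(\mathfrak g;\mathbb R)$ be a 2-cocycle with trivial real coefficients. Let $\mathrm F$ be the right-invariant 2-form $\mathrm F(\zeta_1,\zeta_2)=\mathbf F((R_{g^{-1}})_*\zeta_1,(R_{g^{-1}})_*\zeta_2)$ on $G$. For $\mathrm e\in\mathbb R$ equip $T^*G$ with the symplectic form $\omega_{\mathrm e}=\sum_i \mathrm dg^i\wedge \mathrm dp_i+\mathrm e\,\pi^*\mathrm F$; let $X_\varphi$ be the vector field with $\omega_{\mathrm e}(X_\varphi,\cdot)=\mathrm d\varphi$, and $\{\varphi,\psi\}=-\omega_{\mathrm e}(X_\varphi,X_\psi)$, so that in local coordinates $\{g^i,g^j\}=0$, $\{p_i,g^j\}=\delta_i^j$, $\{p_i,p_j\}=\mathrm e\,\mathrm F_{ij}$. For a right-invariant pseudo-Riemannian metric on $G$, the magnetic geodesic flow is the flow of $X_H$ with $H(g,p)=\tfrac12|p|^2$. An integral of motion is a smooth function on $T^*G$ that is constant along every integral curve of $X_H$. Let $\widetilde{\mathfrak g}=\mathfrak g\oplus\mathbb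 R Z$ be the central extension with $Z$ central and $[X,Y]_{\mathbf F}=[X,Y]+\mathbf F(X,Y)Z$ for $X,Y\in\mathfrak g$. Let $\widetilde G$ be a connected Lie group with Lie algebra $\widetilde{\mathfrak g}$ that is a central extension of $G$: there is a smooth surjective homomorphism $\widetilde G\to G$ whose kernel $T$ is central and which induces $X+sZ\mapsto X$ on Lie algebras. Write $\xi_X=(L_g)_*X$ and $\eta_X=-(R_g)_*X$ for the left- and right-invariant vector fields on $G$, and $\widetilde\xi,\widetilde\eta$ for those on $\widetilde G$. For $Y\in\mathfrak g$ define $\mathbf f(Y):G\to\mathbb R$ by $$\widetilde\xi_Y+\widetilde\eta_{\mathrm{Ad}_gY}=-\mathbf f(Y)(g)\,\widetilde\xi_Z\quad\text{at every point of }\widetilde G\text{ over } g\in G,$$ equivalently by letting $-\mathbf f(Y)(g)$ be the coefficient of $Z$ in $\mathrm{Ad}_{\tilde g}Y$, for any $\tilde g\in\widetilde G$ over $g$. For $X\in\mathfrak g$ put $\xi_X(g,p)=p(\xi_X(g))$ and $\xi^{(\mathrm e)}_X=\xi_X+\mathrm e\,\mathbf f(X)$ on $T^*G$. Let $\mathcal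 A$ be the linear span of the functions $\xi^{(\mathrm e)}_X$, $X\in\mathfrak g$, and of the constants. Then: 1. The functions $\mathbf f(Y)$ are well defined and smooth, and $\mathbf f(Y)=U^{-1}\big(\widetilde\xi_Y+\widetilde\eta_{\mathrm{Ad}_gY}\big)U$ for every nowhere vanishing smooth function $U$ on an open subset of $\widetilde G$ with $\widetilde\xi_ZU=-U$ (that is, $U$ depends on the fibre coordinate $t$ of $T$ as $e^{-t}$). 2. For every right-invariant pseudo-Riemannian metric, each $\xi^{(\mathrm e)}_X$, and hence each function in $\mathcal A$, is an integral of motion of the magnetic geodesic flow, and $\{\xi^{(\mathrm e)}_X,H\}=0$. 3. $\{\xi^{(\mathrm e)}_X,\xi^{(\mathrm e)}_Y\}=\xi^{(\mathrm e)}_{[X,Y]}-\mathrm e\,\mathbf F(X,Y)$ for all $X,Y\in\mathfrak g$. 4. If $\mathrm e\neq0$, then $\mathcal A$ is closed under the Poisson bracket and $X+sZ\mapsto \xi^{(\mathrm e)}_X-\mathrm e s$ is an isomorphism from $\widetilde{\mathfrak g}$ onto $\mathcal A$ that takes the Lie bracket to the Poisson bracket. 5. If $\mathbf F$ is trivial,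 $\mathbf F(X,Y)=\langle\lambda,[X,Y]\rangle$ with $\lambda\in\mathfrak g^*$, then the extension splits: $X\mapsto X+\langle\lambda,X\rangle Z$ is a Lie algebra homomorphism $\mathfrak g\to\widetilde{\mathfrak g}$. Moreover the linear span of the shifted integrals $\xi^{(\mathrm e)}_X-\mathrm e\langle\lambda,X\rangle$ is closed under the Poisson bracket, and $X\mapsto\xi^{(\mathrm e)}_X-\mathrm e\langle\lambda,X\rangle$ is an isomorphism from $\mathfrak g$ onto it. -/

import Mathlib

open scoped Manifold ContDiff
open Bundle LieModule.Cohomology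

noncomputable section

namespace MagneticFlow

/-- A smooth Lie group has the differentiability that the Lie bracket on its tangent space at the
identity requires. -/
instance lieGroupMinSmoothness {E G : Type*} [NormedAddCommGroup E] [NormedSpace ℝ E]
    [TopologicalSpace G] [ChartedSpace E G] [Group G] [LieGroup 𝓘(ℝ, E) ∞ G] :
    LieGroup 𝓘(ℝ, E) (minSmoothness ℝ 3) G :=
  LieGroup.of_le (n := ∞) (by
    rw [minSmoothness_of_isRCLikeNormedField]
    exact ENat.LEInfty.out)

section Group

variable {E : Type*} [NormedAddCommGroup E] [NormedSpace ℝ E]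
  {G : Type*} [TopologicalSpace G] [ChartedSpace E G] [Group G]

/-- The Lie algebra of `G`: the tangent space at the identity, with the bracket of left-invariant
vector fields. -/
abbrev LieAlg (E G : Type*) [NormedAddCommGroup E] [NormedSpace ℝ E]
    [TopologicalSpace G] [ChartedSpace E G] [Group G] : Type _ :=
  GroupLieAlgebra 𝓘(ℝ, E) G

/-- The left-invariant vector field `ξ_X(g) = (L_g)_* X`. -/
def leftField (X : LieAlg E G) (g : G) : TangentSpace 𝓘(ℝ, E) g :=
  mulInvariantVectorField X g

/-- The right-invariant vector field `η_X(g) = -(R_g)_* X`. -/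
def rightField (X : LieAlg E G) (g : G) : TangentSpace 𝓘(ℝ, E) g :=
  -(mfderiv 𝓘(ℝ, E) 𝓘(ℝ, E) (fun h : G => h * g) 1 X : E)

/-- The derivative of a function `U` along a tangent vector at `g`. -/
def derivAlong (U : G → ℝ) (g : G) (v : TangentSpace 𝓘(ℝ, E) g) : ℝ :=
  mfderiv 𝓘(ℝ, E) 𝓘(ℝ, ℝ) U g v

/-- The map `(R_{g⁻¹})_* : T_g G → 𝔤`. -/
def rightTranslateToOne (g : G) : TangentSpace 𝓘(ℝ, E) g →L[ℝ] LieAlg E G :=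
  (mfderiv 𝓘(ℝ, E) 𝓘(ℝ, E) (fun h : G => h * g⁻¹) g : E →L[ℝ] E)

/-- The map `(R_g)_* : 𝔤 → T_g G`. -/
def rightTranslateFromOne (g : G) : LieAlg E G →L[ℝ] TangentSpace 𝓘(ℝ, E) g :=
  (mfderiv 𝓘(ℝ, E) 𝓘(ℝ, E) (fun h : G => h * g) 1 : E →L[ℝ] E)

/-- The adjoint action `Ad_g : 𝔤 → 𝔤`, the derivative at the identity of `h ↦ g h g⁻¹`. -/
def Ad (g : G) : LieAlg E G →L[ℝ] LieAlg E G :=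
  (mfderiv 𝓘(ℝ, E) 𝓘(ℝ, E) (fun h : G => g * h * g⁻¹) 1 : E →L[ℝ] E)

/-- The cotangent bundle `T^*G`; a point is written `⟨g, p⟩` with `p : T_g G →L[ℝ] ℝ`. -/
abbrev Cotangent (E G : Type*) [NormedAddCommGroup E] [NormedSpace ℝ E]
    [TopologicalSpace G] [ChartedSpace E G] : Type _ :=
  TotalSpace (E →L[ℝ] ℝ) (fun g : G => TangentSpace 𝓘(ℝ, E) g →L[ℝ] ℝ)

/-- The model with corners of `T^*G`. -/
abbrev cotangentModel (E : Type*) [NormedAddCommGroup E] [NormedSpace ℝ E] :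
    ModelWithCorners ℝ (E × (E →L[ℝ] ℝ)) (ModelProd E (E →L[ℝ] ℝ)) :=
  𝓘(ℝ, E).prod 𝓘(ℝ, E →L[ℝ] ℝ)

/-- The left-invariant function `ξ_X(g, p) = p(ξ_X(g))` on `T^*G`. -/
def leftFunction (X : LieAlg E G) (x : Cotangent E G) : ℝ :=
  x.2 (leftField X x.1)

/-- The Hamiltonian `H(g, p) = |p|² / 2` of the right-invariant pseudo-Riemannian metric on `G`
whose value at the identity is `B`; here `|p|²` is the value at `(R_g)^* p ∈ 𝔤^*` of the quadratic
form on `𝔤^*` inverse to `B`. -/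
def metricHamiltonian [FiniteDimensional ℝ E] (B : LinearMap.BilinForm ℝ (LieAlg E G))
    (hB : B.Nondegenerate) (x : Cotangent E G) : ℝ :=
  haveI : FiniteDimensional ℝ (LieAlg E G) := inferInstanceAs (FiniteDimensional ℝ E)
  let q : Module.Dual ℝ (LieAlg E G) := (x.2.comp (rightTranslateFromOne x.1)).toLinearMap
  (1 / 2) * q ((B.toDual hB).symm q)

variable [CompleteSpace E] [LieGroup 𝓘(ℝ, E) ∞ G]

/-- The space `Z²(𝔤; ℝ)` of real 2-cocycles with trivial coefficients. -/
abbrev Cocycle (E G : Type*) [NormedAddCommGroup E] [NormedSpace ℝ E] [CompleteSpace E]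
    [TopologicalSpace G] [ChartedSpace E G] [Group G] [LieGroup 𝓘(ℝ, E) ∞ G] : Type _ :=
  twoCocycle ℝ (LieAlg E G) (TrivialLieModule ℝ (LieAlg E G) ℝ)

/-- The underlying real-valued bilinear form `(X, Y) ↦ F(X, Y)` of a 2-cocycle. -/
def Cocycle.form (F : Cocycle E G) : LieAlg E G →ₗ[ℝ] LieAlg E G →ₗ[ℝ] ℝ :=
  (F.1.1).compr₂ (TrivialLieModule.equiv ℝ (LieAlg E G) ℝ).toLinearMap

/-- The right-invariant 2-form on `G` with value `F` at the identity. -/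
def magneticForm (F : Cocycle E G) (g : G) (v w : TangentSpace 𝓘(ℝ, E) g) : ℝ :=
  F.form (rightTranslateToOne g v) (rightTranslateToOne g w)

/-- The deformed symplectic form `ω + e π^*F` on `T^*G`, where `ω = ∑ dgⁱ ∧ dpᵢ`.

The tangent space of `T^*G` at `x = (g, p)` is `E × (E →L[ℝ] ℝ)`, read in the chart of `T^*G` at
`x`. This is the canonical chart `(gⁱ, pᵢ)` induced by the chart of `G` at `g`, so a tangent vector
is the pair of its components `(dgⁱ, dpᵢ)`, and the first one is its image in `T_g G = E`. -/
def symplecticForm (e : ℝ) (F : Cocycle E G) (x : Cotangent E G)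
    (v w : TangentSpace (cotangentModel E) x) : ℝ :=
  let v' : E × (E →L[ℝ] ℝ) := v
  let w' : E × (E →L[ℝ] ℝ) := w
  w'.2 v'.1 - v'.2 w'.1 + e * magneticForm F x.1 v'.1 w'.1

theorem magneticForm_add_left (F : Cocycle E G) (g : G) (a b c : E) :
    magneticForm F g (a + b : E) c = magneticForm F g a c + magneticForm F g b c := by
  have : rightTranslateToOne g (a + b : E) =
      rightTranslateToOne (E := E) g a + rightTranslateToOne (E := E) g b :=
    (rightTranslateToOne (E := E) g).map_add a b
  simp [magneticForm, this]

theorem magneticForm_add_right (F : Cocycle E G) (g : G) (a b c : E) :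
    magneticForm F g a (b + c : E) = magneticForm F g a b + magneticForm F g a c := by
  have : rightTranslateToOne g (b + c : E) =
      rightTranslateToOne (E := E) g b + rightTranslateToOne (E := E) g c :=
    (rightTranslateToOne (E := E) g).map_add b c
  simp [magneticForm, this]

theorem magneticForm_smul_right (F : Cocycle E G) (g : G) (r : ℝ) (a b : E) :
    magneticForm F g a (r • b : E) = r * magneticForm F g a b := by
  have : rightTranslateToOne g (r • b : E) = r • rightTranslateToOne (E := E) g b :=
    (rightTranslateToOne (E := E) g).map_smul r b
  simp [magneticForm, this]

/-- The form `ω + e π^*F` is nondegenerate: every function on `T^*G` has exactly one Hamiltonian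
vector at each point. -/
theorem existsUnique_hamiltonianVector [FiniteDimensional ℝ E] (e : ℝ) (F : Cocycle E G)
    (φ : Cotangent E G → ℝ) (x : Cotangent E G) :
    ∃! V : TangentSpace (cotangentModel E) x, ∀ ζ : TangentSpace (cotangentModel E) x,
      symplecticForm e F x V ζ = mfderiv (cotangentModel E) 𝓘(ℝ, ℝ) φ x ζ := by
  let D : (E × (E →L[ℝ] ℝ)) →L[ℝ] ℝ := mfderiv (cotangentModel E) 𝓘(ℝ, ℝ) φ x
  -- the point `a` of `E` that represents `D (0, ·)`
  obtain ⟨a, ha⟩ : ∃ a : E, ∀ β : E →L[ℝ] ℝ, β a = D (0, β) := by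
    let ℓ : Module.Dual ℝ (Module.Dual ℝ E) :=
      (D.toLinearMap.comp (LinearMap.inr ℝ E (E →L[ℝ] ℝ))).comp
        (LinearMap.toContinuousLinearMap (𝕜 := ℝ) (E := E) (F' := ℝ)).toLinearMap
    refine ⟨(Module.evalEquiv ℝ E).symm ℓ, fun β => ?_⟩
    have h := Module.apply_evalEquiv_symm_apply ℝ E β.toLinearMap ℓ
    exact h
  let b : E →L[ℝ] ℝ := LinearMap.toContinuousLinearMap
    { toFun := fun w => e * magneticForm F x.1 a w - D (w, 0)
      map_add' := fun w w' => by
        have : D (w + w', 0) = D (w, 0) + D (w', 0) := by rw [← map_add]; simp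
        rw [magneticForm_add_right, this]; ring
      map_smul' := fun r w => by
        have : D (r • w, 0) = r * D (w, 0) := by
          rw [← smul_eq_mul, ← map_smul]; simp
        rw [magneticForm_smul_right, this]
        simp only [RingHom.id_apply, smul_eq_mul]; ring }
  have hb : ∀ w, b w = e * magneticForm F x.1 a w - D (w, 0) := fun _ => rfl
  refine ⟨((a, b) : E × (E →L[ℝ] ℝ)), ?_, ?_⟩
  · rintro ⟨w, β⟩
    change β a - b w + e * magneticForm F x.1 a w = D (w, β)
    have : D (w, β) = D (w, 0) + D (0, β) := by rw [← map_add]; simp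
    rw [this, hb, ha]; ring
  · rintro ⟨a', b'⟩ h
    have h' : ∀ (w : E) (β : E →L[ℝ] ℝ),
        β a' - b' w + e * magneticForm F x.1 a' w = D (w, β) := fun w β => h (w, β)
    have hF : ∀ c : E, magneticForm F x.1 c (0 : E) = 0 := fun c => by
      simpa using magneticForm_smul_right F x.1 0 c 0
    have haa : a' = a := by
      by_contra hne
      obtain ⟨β, hβ⟩ := exists_dual_vector (𝕜 := ℝ) (a' - a)
        (norm_ne_zero_iff.mpr (sub_ne_zero.mpr hne))
      have h0 := h' 0 β
      rw [hF, ← ha β] at h0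
      have h2 : β (a' - a) = 0 := by rw [map_sub]; simp at h0; linarith
      rw [h2] at hβ
      exact sub_ne_zero.mpr hne (by simpa using hβ.2.symm)
    subst haa
    have hbb : b' = b := by
      ext w
      have h0 := h' w 0
      rw [hb]
      simp at h0
      linarith
    subst hbb
    rfl

variable [FiniteDimensional ℝ E]

/-- The Hamiltonian vector field `X_φ` of a function `φ` on `T^*G`:
`(ω + e π^*F)(X_φ, ζ) = dφ(ζ)`. -/
def hamiltonianField (e : ℝ) (F : Cocycle E G) (φ : Cotangent E G → ℝ) (x : Cotangent E G) :
    TangentSpace (cotangentModel E) x :=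
  (existsUnique_hamiltonianVector e F φ x).choose

/-- The Poisson bracket `{φ, ψ} = -(ω + e π^*F)(X_φ, X_ψ)` of the deformed symplectic form. In
canonical coordinates `{gⁱ, gʲ} = 0`, `{pᵢ, gʲ} = δᵢʲ`, `{pᵢ, pⱼ} = e Fᵢⱼ`. -/
def poissonBracket (e : ℝ) (F : Cocycle E G) (φ ψ : Cotangent E G → ℝ) (x : Cotangent E G) : ℝ :=
  -symplecticForm e F x (hamiltonianField e F φ x) (hamiltonianField e F ψ x)

/-- A smooth function on `T^*G` is an integral of motion of the Hamiltonian system of `H` if it is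
constant along every integral curve of the Hamiltonian vector field of `H`. -/
def IsIntegralOfMotion (e : ℝ) (F : Cocycle E G) (H φ : Cotangent E G → ℝ) : Prop :=
  ContMDiff (cotangentModel E) 𝓘(ℝ, ℝ) ∞ φ ∧
    ∀ (γ : ℝ → Cotangent E G) (s : Set ℝ), IsOpen s → s.OrdConnected →
      IsMIntegralCurveOn (I := cotangentModel E) γ (hamiltonianField e F H) s →
      ∀ t ∈ s, ∀ u ∈ s, φ (γ t) = φ (γ u)

/-- The Lie algebra `𝔤̃ = 𝔤 ⊕ ℝ Z` with `[X + sZ, Y + tZ] = [X, Y] + F(X, Y) Z`. -/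
abbrev CentralExt (F : Cocycle E G) : Type _ := LieAlgebra.ofTwoCocycle F

/-- The element `X + sZ` of `𝔤̃`. -/
def CentralExt.mk (F : Cocycle E G) (X : LieAlg E G) (s : ℝ) : CentralExt F :=
  LieAlgebra.ofProd F (X, (TrivialLieModule.equiv ℝ (LieAlg E G) ℝ).symm s)

/-- The coefficient `s` of `Z` in `X + sZ`. -/
def CentralExt.coeff (F : Cocycle E G) : CentralExt F →ₗ[ℝ] ℝ where
  toFun a := TrivialLieModule.equiv ℝ (LieAlg E G) ℝ ((LieAlgebra.ofProd F).symm a).2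
  map_add' _ _ := rfl
  map_smul' _ _ := rfl

end Group

section Extension

variable {E : Type*} [NormedAddCommGroup E] [NormedSpace ℝ E] [FiniteDimensional ℝ E]
  [CompleteSpace E]
  {G : Type*} [TopologicalSpace G] [ChartedSpace E G] [Group G] [LieGroup 𝓘(ℝ, E) ∞ G]
  {E' : Type*} [NormedAddCommGroup E'] [NormedSpace ℝ E'] [CompleteSpace E']
  {G' : Type*} [TopologicalSpace G'] [ChartedSpace E' G'] [Group G'] [LieGroup 𝓘(ℝ, E') ∞ G']

/-- The Lie group `G'` with Lie algebra `Φ : 𝔤̃ ≃ Lie(G')` is a central extension of `G`: the smooth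
surjective homomorphism `ρ : G' → G` has central kernel and induces the projection
`X + sZ ↦ X` on Lie algebras (so that its kernel has Lie algebra `ℝ Z`). -/
structure IsCentralExtension (F : Cocycle E G) (ρ : G' →* G)
    (Φ : CentralExt F ≃ₗ⁅ℝ⁆ LieAlg E' G') : Prop where
  contMDiff : ContMDiff 𝓘(ℝ, E') 𝓘(ℝ, E) ∞ ρ
  surjective : Function.Surjective ρ
  ker_le_center : ρ.ker ≤ Subgroup.center G'
  mfderiv_one : ∀ (X : LieAlg E G) (s : ℝ),
    (mfderiv 𝓘(ℝ, E') 𝓘(ℝ, E) ρ 1 (Φ (CentralExt.mk F X s)) : E) = X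

/-- The 1-cochain `f`: `-f(Y)(g)` is the coefficient of `Z` in `Ad_h Y`, where `h` is a point of
`G'` over `g` (any two choices give the same value, as the kernel is central). Equivalently
`f(Y) = U⁻¹ (ξ̃_Y + η̃_{Ad_g Y}) U |_G` with `U(t) = exp(-t)` on the kernel. -/
def potentialCochain (F : Cocycle E G) (ρ : G' →* G) (Φ : CentralExt F ≃ₗ⁅ℝ⁆ LieAlg E' G')
    (h : IsCentralExtension F ρ Φ) : LieAlg E G →ₗ[ℝ] (G → ℝ) where
  toFun Y g := -CentralExt.coeff F
    (Φ.symm (Ad (Function.surjInv h.surjective g) (Φ (CentralExt.mk F Y 0))))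
  map_add' X Y := by
    have : CentralExt.mk F (X + Y) 0 = CentralExt.mk F X 0 + CentralExt.mk F Y 0 := by
      simp [CentralExt.mk, ← LieAlgebra.of_add]
    funext g
    simp only [this, map_add, neg_add, Pi.add_apply]
  map_smul' r X := by
    have : CentralExt.mk F (r • X) 0 = r • CentralExt.mk F X 0 := by
      simp [CentralExt.mk, ← LieAlgebra.of_smul]
    funext g
    simp [this]

/-- The deformed left-invariant function `ξ^(e)_X = ξ_X + e f(X)` on `T^*G`. -/
def deformedFunction (e : ℝ) (f : LieAlg E G →ₗ[ℝ] (G → ℝ)) (X : LieAlg E G)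
    (x : Cotangent E G) : ℝ :=
  leftFunction X x + e * f X x.1

/-- The linear span of the functions `ξ^(e)_X` and of the constants. -/
def integralAlgebra (e : ℝ) (f : LieAlg E G →ₗ[ℝ] (G → ℝ)) : Submodule ℝ (Cotangent E G → ℝ) :=
  Submodule.span ℝ (Set.range (deformedFunction e f) ∪ {fun _ => 1})

end Extension

end MagneticFlow

end

open MagneticFlow

noncomputable section

/-! The whole theorem is read off from the adjoint action of the extension `G'`. Since `Z` is
central and `G'` is connected, `Ad_k` fixes `Z` (`adL_lift_center`). As `ρ` intertwines the adjoint
actions, for `k` over `g` this leaves `Ad_k Y = Ad_g Y - f(Y)(g) Z` (`adL_lift`). The identity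
`(L_k)_* = (R_k)_* Ad_k` turns this into the formula for `ξ̃_Y + η̃_{Ad_g Y}`, and applying that
field to `U` with `ξ̃_Z U = -U` returns `f(Y)`.

Two properties of `Ad` yield two identities when the coefficient of `Z` is compared. Differentiating
`Ad_k Y` along a left-invariant field gives `ξ_X f(Y) = f([X, Y]) - F(X, Y)`
(`mderiv_potentialCochain`). That `Ad_k` is a Lie algebra homomorphism gives `f([X, Y]) = F(X, Y) -
F(Ad_g X, Ad_g Y)` (`potentialCochain_lieBr`).

On the symplectic side, functions affine in the momenta satisfy `{p(V) + c, p(W) + d} = p([V, W]) +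
V d - W c + e F(V, W)` (`poissonBracket_affineFunction`). The magnetic form is right-invariant, so
it takes the value `F(Ad_g X, Ad_g Y)` on left-invariant fields. Substituting the two identities
gives the commutation relations. Against a right-invariant momentum the bracket vanishes, because
left and right fields commute and the derivative of `f` cancels the magnetic term. The Hamiltonian
is quadratic in right-invariant momenta, so it commutes with every `ξ^(e)_X` by the Leibniz rule.

The isomorphisms then need only injectivity, tested on the fibre over the identity, and the
bookkeeping of constants. -/

namespace MagneticFlow

open scoped Manifold ContDiff Topology
open Bundle LieModule.Cohomology VectorField Filter

/-! ### Derivatives of maps of manifolds, valued in the model spaces. -/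

section Derivative

variable (E : Type*) [NormedAddCommGroup E] [NormedSpace ℝ E]
  {M : Type*} [TopologicalSpace M] [ChartedSpace E M]
  (E' : Type*) [NormedAddCommGroup E'] [NormedSpace ℝ E']
  {N : Type*} [TopologicalSpace N] [ChartedSpace E' N]
  {E'' : Type*} [NormedAddCommGroup E''] [NormedSpace ℝ E'']
  {P : Type*} [TopologicalSpace P] [ChartedSpace E'' P]
  {F : Type*} [NormedAddCommGroup F] [NormedSpace ℝ F]

/-- The derivative of a map of manifolds, as a linear map between the model spaces. -/
def mderiv (f : M → N) (x : M) : E →L[ℝ] E' :=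
  mfderiv 𝓘(ℝ, E) 𝓘(ℝ, E') f x

variable {E E'}

theorem mderiv_comp {g : N → P} {f : M → N} {x : M}
    (hg : MDifferentiableAt 𝓘(ℝ, E') 𝓘(ℝ, E'') g (f x))
    (hf : MDifferentiableAt 𝓘(ℝ, E) 𝓘(ℝ, E') f x) :
    mderiv E E'' (g ∘ f) x = (mderiv E' E'' g (f x)).comp (mderiv E E' f x) :=
  mfderiv_comp x hg hf

/-- The base point `y` is kept separate from `f x`, so that equalities such as `g * 1 = g` need no
rewriting inside dependent types. -/
theorem mderiv_comp_apply {g : N → P} {f : M → N} {x : M} {y : N} (hy : f x = y)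
    (hg : MDifferentiableAt 𝓘(ℝ, E') 𝓘(ℝ, E'') g y)
    (hf : MDifferentiableAt 𝓘(ℝ, E) 𝓘(ℝ, E') f x) (v : E) :
    mderiv E E'' (fun z => g (f z)) x v = mderiv E' E'' g y (mderiv E E' f x v) := by
  subst hy
  exact congrArg (fun L : E →L[ℝ] E'' => L v) (mderiv_comp hg hf)

theorem mderiv_congr {f g : M → N} {x : M} (h : f =ᶠ[𝓝 x] g) :
    mderiv E E' f x = mderiv E E' g x :=
  h.mfderiv_eq

theorem mderiv_id (x : M) : mderiv E E (fun y : M => y) x = ContinuousLinearMap.id ℝ E :=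
  mfderiv_id

theorem mderiv_const (c : N) (x : M) : mderiv E E' (fun _ : M => c) x = 0 :=
  mfderiv_const

theorem mderiv_eq_fderiv (f : E → F) (x : E) : mderiv E F f x = fderiv ℝ f x :=
  mfderiv_eq_fderiv

/-- For a function to a vector space, the manifold derivative is the derivative in the chart. -/
theorem hasFDerivAt_comp_chart_symm {u : M → F} {g : M}
    (hu : MDifferentiableAt 𝓘(ℝ, E) 𝓘(ℝ, F) u g) :
    HasFDerivAt (u ∘ (extChartAt 𝓘(ℝ, E) g).symm) (mderiv E F u g) (extChartAt 𝓘(ℝ, E) g g) := by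
  have h := hu.hasMFDerivAt.2
  rw [modelWithCornersSelf_coe, Set.range_id] at h
  exact hasFDerivWithinAt_univ.1 h

theorem mderiv_eq_fderiv_chart {u : M → F} {g : M}
    (hu : MDifferentiableAt 𝓘(ℝ, E) 𝓘(ℝ, F) u g) :
    mderiv E F u g = fderiv ℝ (u ∘ (extChartAt 𝓘(ℝ, E) g).symm) (extChartAt 𝓘(ℝ, E) g g) :=
  (hasFDerivAt_comp_chart_symm hu).fderiv.symm

end Derivative

/-! ### Vector fields and their Lie bracket in the chart at a point. -/

section VectorFields

variable {E : Type*} [NormedAddCommGroup E] [NormedSpace ℝ E]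
  {M : Type*} [TopologicalSpace M] [ChartedSpace E M]

/-- The derivative of the chart at `g` along the vector field `V`, as a function to the model
space. -/
def chartDerivative (g : M) (V : M → E) (x : M) : E :=
  mderiv E E (extChartAt 𝓘(ℝ, E) g) x (V x)

/-- A map to the model space as a section of the tangent bundle. -/
def tangentSection (V : M → E) (x : M) : TangentBundle 𝓘(ℝ, E) M := ⟨x, V x⟩

/-- The Lie bracket of two vector fields, given as maps to the model space. -/
def vectorBracket (V W : M → E) (g : M) : E := mlieBracket 𝓘(ℝ, E) V W g

variable [IsManifold 𝓘(ℝ, E) ∞ M]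

theorem mderiv_extChartAt_self (g : M) :
    mderiv E E (extChartAt 𝓘(ℝ, E) g) g = ContinuousLinearMap.id ℝ E :=
  mfderiv_extChartAt_self

theorem chartDerivative_self (g : M) (V : M → E) :
    chartDerivative g V g = V g := by
  rw [chartDerivative, mderiv_extChartAt_self]
  rfl

theorem continuousLinearMapAt_trivializationAt_eq_mderiv {g x : M}
    (hx : x ∈ (chartAt E g).source) :
    ((trivializationAt E (TangentSpace 𝓘(ℝ, E)) g).continuousLinearMapAt ℝ x : E →L[ℝ] E) =
      mderiv E E (extChartAt 𝓘(ℝ, E) g) x :=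
  TangentBundle.continuousLinearMapAt_trivializationAt hx

theorem chartDerivative_eq_trivializationAt {g x : M} (V : M → E)
    (hx : x ∈ (chartAt E g).source) :
    chartDerivative g V x = (trivializationAt E (TangentSpace 𝓘(ℝ, E)) g (tangentSection V x)).2 := by
  rw [chartDerivative, ← continuousLinearMapAt_trivializationAt_eq_mderiv hx]
  exact (trivializationAt E (TangentSpace 𝓘(ℝ, E)) g).continuousLinearMapAt_apply_of_mem
    (R := ℝ) hx (V x)

theorem mdifferentiableAt_chartDerivative {g : M} {V : M → E}
    (hV : MDifferentiableAt 𝓘(ℝ, E) (𝓘(ℝ, E).prod 𝓘(ℝ, E))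
      (tangentSection V) g) :
    MDifferentiableAt 𝓘(ℝ, E) 𝓘(ℝ, E) (chartDerivative g V) g := by
  refine ((mdifferentiableAt_section 𝓘(ℝ, E) (E := TangentSpace 𝓘(ℝ, E)) V).1 hV).congr_of_eventuallyEq ?_
  filter_upwards [(chartAt E g).open_source.mem_nhds (mem_chart_source E g)] with x hx
  exact chartDerivative_eq_trivializationAt V hx

/-- Pulling back by the inverse chart applies the inverse of its derivative, and that is the
derivative of the chart. This links the definition of `mlieBracket` to `chartDerivative`. -/
theorem mpullbackWithin_chart_symm_eventuallyEq (g : M) (U : M → E) :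
    mpullbackWithin 𝓘(ℝ, E) 𝓘(ℝ, E) (extChartAt 𝓘(ℝ, E) g).symm U (Set.range 𝓘(ℝ, E))
        =ᶠ[𝓝 (extChartAt 𝓘(ℝ, E) g g)]
      (chartDerivative g U ∘ (extChartAt 𝓘(ℝ, E) g).symm) := by
  filter_upwards [extChartAt_target_mem_nhds (I := 𝓘(ℝ, E)) g] with y hy
  exact congrArg (fun L : E →L[ℝ] E => L (U ((extChartAt 𝓘(ℝ, E) g).symm y)))
    (ContinuousLinearMap.inverse_eq
    (mfderivWithin_extChartAt_symm_comp_mfderiv_extChartAt hy)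
    (mfderiv_extChartAt_comp_mfderivWithin_extChartAt_symm hy))

/-- The Lie bracket of two vector fields at `g`, through their action on the chart at `g`. -/
theorem mlieBracket_eq_mderiv_chartDerivative {g : M} {V W : M → E}
    (hV : MDifferentiableAt 𝓘(ℝ, E) 𝓘(ℝ, E) (chartDerivative g V) g)
    (hW : MDifferentiableAt 𝓘(ℝ, E) 𝓘(ℝ, E) (chartDerivative g W) g) :
    vectorBracket V W g =
      mderiv E E (chartDerivative g W) g (V g) - mderiv E E (chartDerivative g V) g (W g) := by
  have hval (U : M → E) :
      (chartDerivative g U ∘ (extChartAt 𝓘(ℝ, E) g).symm) (extChartAt 𝓘(ℝ, E) g g) = U g := by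
    rw [Function.comp_apply, extChartAt_to_inv, chartDerivative_self]
  let pull (U : M → E) : E → E :=
    mpullbackWithin 𝓘(ℝ, E) 𝓘(ℝ, E) (extChartAt 𝓘(ℝ, E) g).symm U (Set.range 𝓘(ℝ, E))
  have hb : lieBracketWithin ℝ (pull V) (pull W) Set.univ (extChartAt 𝓘(ℝ, E) g g) =
      lieBracket ℝ (chartDerivative g V ∘ (extChartAt 𝓘(ℝ, E) g).symm)
        (chartDerivative g W ∘ (extChartAt 𝓘(ℝ, E) g).symm) (extChartAt 𝓘(ℝ, E) g g) := by
    rw [lieBracketWithin_univ]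
    exact Filter.EventuallyEq.lieBracket_vectorField_eq
      (mpullbackWithin_chart_symm_eventuallyEq g V) (mpullbackWithin_chart_symm_eventuallyEq g W)
  rw [mderiv_eq_fderiv_chart hV, mderiv_eq_fderiv_chart hW]
  have h0 : vectorBracket V W g =
      (mderiv E E (extChartAt 𝓘(ℝ, E) g) g).inverse (lieBracketWithin ℝ (pull V) (pull W)
      ((extChartAt 𝓘(ℝ, E) g).symm ⁻¹' Set.univ ∩ Set.range 𝓘(ℝ, E)) (extChartAt 𝓘(ℝ, E) g g)) := rfl
  have h1 : (extChartAt 𝓘(ℝ, E) g).symm ⁻¹' Set.univ ∩ Set.range 𝓘(ℝ, E) = Set.univ := by simp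
  rw [h0, h1, mderiv_extChartAt_self, ContinuousLinearMap.inverse_id, hb, lieBracket, hval, hval]
  rfl

end VectorFields

/-! ### Smooth dependence and symmetry of partial derivatives on products. -/

section MixedDerivatives

variable {E : Type*} [NormedAddCommGroup E] [NormedSpace ℝ E]
  {M : Type*} [TopologicalSpace M] [ChartedSpace E M]
  {E' : Type*} [NormedAddCommGroup E'] [NormedSpace ℝ E']
  {N : Type*} [TopologicalSpace N] [ChartedSpace E' N]
  {F : Type*} [NormedAddCommGroup F] [NormedSpace ℝ F]

/-- Partial derivatives of a twice differentiable function on a product commute. -/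
theorem fderiv_fderiv_comm {ψ : E × E' → F} {a : E} {b : E'} (hψ : ContDiffAt ℝ 2 ψ (a, b))
    (v : E) (w : E') :
    fderiv ℝ (fun y => fderiv ℝ (fun x => ψ (x, y)) a v) b w =
      fderiv ℝ (fun x => fderiv ℝ (fun y => ψ (x, y)) b w) a v := by
  have hs := hψ.isSymmSndFDerivAt (by simp)
  have hd : DifferentiableAt ℝ (fderiv ℝ ψ) (a, b) :=
    (hψ.fderiv_right (m := 1) (by norm_num)).differentiableAt (by simp)
  have hev : ∀ᶠ z in 𝓝 (a, b), DifferentiableAt ℝ ψ z := by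
    filter_upwards [hψ.eventually (by simp)] with z hz
    exact hz.differentiableAt (by simp)
  have h1 : (fun y => fderiv ℝ (fun x => ψ (x, y)) a v) =ᶠ[𝓝 b]
      fun y => fderiv ℝ ψ (a, y) (v, 0) := by
    have : Tendsto (fun y : E' => (a, y)) (𝓝 b) (𝓝 (a, b)) :=
      (Continuous.prodMk_right a).tendsto b
    filter_upwards [this.eventually hev] with y hy
    have h := hy.hasFDerivAt.comp a (hasFDerivAt_prodMk_left (𝕜 := ℝ) a y)
    rw [show (fun x => ψ (x, y)) = ψ ∘ fun x => (x, y) from rfl, h.fderiv]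
    simp
  have h2 : (fun x => fderiv ℝ (fun y => ψ (x, y)) b w) =ᶠ[𝓝 a]
      fun x => fderiv ℝ ψ (x, b) (0, w) := by
    have : Tendsto (fun x : E => (x, b)) (𝓝 a) (𝓝 (a, b)) :=
      (Continuous.prodMk_left b).tendsto a
    filter_upwards [this.eventually hev] with x hx
    have h := hx.hasFDerivAt.comp b (hasFDerivAt_prodMk_right (𝕜 := ℝ) x b)
    rw [show (fun y => ψ (x, y)) = ψ ∘ fun y => (x, y) from rfl, h.fderiv]
    simp
  have d1 : HasFDerivAt (fun y => fderiv ℝ ψ (a, y) (v, 0)) _ b :=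
    (hd.hasFDerivAt.comp b (hasFDerivAt_prodMk_right (𝕜 := ℝ) a b)).clm_apply
      (hasFDerivAt_const ((v, 0) : E × E') b)
  have d2 : HasFDerivAt (fun x => fderiv ℝ ψ (x, b) (0, w)) _ a :=
    (hd.hasFDerivAt.comp a (hasFDerivAt_prodMk_left (𝕜 := ℝ) a b)).clm_apply
      (hasFDerivAt_const ((0, w) : E × E') a)
  rw [h1.fderiv_eq, h2.fderiv_eq, d1.fderiv, d2.fderiv]
  simpa using hs.eq (0, w) (v, 0)

theorem contMDiffAt_eventually [IsManifold 𝓘(ℝ, E) ∞ M] [IsManifold 𝓘(ℝ, E') ∞ N]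
    {E'' : Type*} [NormedAddCommGroup E''] [NormedSpace ℝ E'']
    {P : Type*} [TopologicalSpace P] [ChartedSpace E'' P] [IsManifold 𝓘(ℝ, E'') ∞ P]
    {f : M × N → P} {z : M × N}
    (hf : ContMDiffAt (𝓘(ℝ, E).prod 𝓘(ℝ, E')) 𝓘(ℝ, E'') ∞ f z) :
    ∀ᶠ y in 𝓝 z, ContMDiffAt (𝓘(ℝ, E).prod 𝓘(ℝ, E')) 𝓘(ℝ, E'') 1 f y :=
  (contMDiffAt_iff_contMDiffAt_nhds (by simp)).1 (hf.of_le ENat.LEInfty.out)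

/-- The partial derivative of a smooth function of two variables depends smoothly on the other
variable. -/
theorem contMDiffAt_mderiv [IsManifold 𝓘(ℝ, E) ∞ M] [IsManifold 𝓘(ℝ, E') ∞ N]
    {f : M → N → F} {x₀ : M} {y₀ : N}
    (hf : ContMDiffAt (𝓘(ℝ, E).prod 𝓘(ℝ, E')) 𝓘(ℝ, F) ∞ (Function.uncurry f) (x₀, y₀)) :
    ContMDiffAt 𝓘(ℝ, E) 𝓘(ℝ, E' →L[ℝ] F) ∞ (fun x => mderiv E' F (f x) y₀) x₀ := by
  have h := ContMDiffAt.mfderiv (m := ∞) (n := ∞) f (fun _ : M => y₀) hf contMDiffAt_const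
    (Std.IsPreorder.le_refl (∞ + 1))
  refine h.congr_of_eventuallyEq (.of_forall fun x => ?_)
  refine Eq.trans ?_ (inTangentCoordinates_eq_mfderiv_comp (I := 𝓘(ℝ, E')) (I' := 𝓘(ℝ, F)) (mem_chart_source E' y₀)
    (Set.mem_univ _)).symm
  rw [mfderivWithin_range_extChartAt_symm]
  have : mfderiv 𝓘(ℝ, F) 𝓘(ℝ, F) (extChartAt 𝓘(ℝ, F) (f x₀ y₀)) (f x y₀) =
    ContinuousLinearMap.id ℝ F := mfderiv_id
  rw [this]
  rfl

/-- The derivative at a fixed point of a smooth family of maps that fixes that point depends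
smoothly on the parameter. -/
theorem contMDiffAt_mderiv_of_fixed [IsManifold 𝓘(ℝ, E) ∞ M] [IsManifold 𝓘(ℝ, E') ∞ N]
    {f : M → N → N} {x₀ : M} {y₀ : N} (hy : ∀ x, f x y₀ = y₀)
    (hf : ContMDiffAt (𝓘(ℝ, E).prod 𝓘(ℝ, E')) 𝓘(ℝ, E') ∞ (Function.uncurry f) (x₀, y₀)) :
    ContMDiffAt 𝓘(ℝ, E) 𝓘(ℝ, E' →L[ℝ] E') ∞ (fun x => mderiv E' E' (f x) y₀) x₀ := by
  -- Composing with the chart at the fixed point gives a vector-valued family without changing the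
  -- derivative, since that chart has identity derivative at its own base point.
  have hs : ContMDiffAt 𝓘(ℝ, E') 𝓘(ℝ, E') ∞ (extChartAt 𝓘(ℝ, E') y₀) y₀ := contMDiffAt_extChartAt
  have h := contMDiffAt_mderiv (f := fun x y => extChartAt 𝓘(ℝ, E') y₀ (f x y)) (x₀ := x₀)
    (y₀ := y₀) (hs.comp_of_eq hf (hy x₀))
  refine h.congr_of_eventuallyEq ?_
  have hd : ∀ᶠ x in 𝓝 x₀, MDifferentiableAt 𝓘(ℝ, E') 𝓘(ℝ, E') (f x) y₀ := by
    have h1 : ∀ᶠ z in 𝓝 (x₀, y₀), ContMDiffAt (𝓘(ℝ, E).prod 𝓘(ℝ, E')) 𝓘(ℝ, E') 1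
        (Function.uncurry f) z :=
      contMDiffAt_eventually hf
    have h2 : Tendsto (fun x : M => (x, y₀)) (𝓝 x₀) (𝓝 (x₀, y₀)) :=
      (Continuous.prodMk_left y₀).tendsto x₀
    filter_upwards [h2.eventually h1] with x hx
    have := hx.comp y₀ (f := fun y : N => (x, y)) (contMDiffAt_const.prodMk contMDiffAt_id)
    exact this.mdifferentiableAt (by simp)
  filter_upwards [hd] with x hx
  ext v
  rw [mderiv_comp_apply (hy x) (hs.mdifferentiableAt (by simp)) hx, mderiv_extChartAt_self]
  rfl

/-- Partial derivatives of a smooth function on a product of manifolds commute. -/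
theorem mderiv_mderiv_comm [IsManifold 𝓘(ℝ, E) ∞ M] [IsManifold 𝓘(ℝ, E') ∞ N]
    {f : M → N → F} {x₀ : M} {y₀ : N}
    (hf : ContMDiffAt (𝓘(ℝ, E).prod 𝓘(ℝ, E')) 𝓘(ℝ, F) ∞ (Function.uncurry f) (x₀, y₀))
    (v : E) (w : E') :
    mderiv E' F (fun y => mderiv E F (fun x => f x y) x₀ v) y₀ w =
      mderiv E F (fun x => mderiv E' F (f x) y₀ w) x₀ v := by
  have hf' : ContMDiffAt (𝓘(ℝ, E').prod 𝓘(ℝ, E)) 𝓘(ℝ, F) ∞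
      (Function.uncurry fun y x => f x y) (y₀, x₀) :=
    ContMDiffAt.comp (I' := 𝓘(ℝ, E).prod 𝓘(ℝ, E')) (g := Function.uncurry f)
      (f := fun p : N × M => (p.2, p.1)) (y₀, x₀) hf
      (contMDiffAt_snd.prodMk contMDiffAt_fst)
  have m1 : MDifferentiableAt 𝓘(ℝ, E') 𝓘(ℝ, F) (fun y => mderiv E F (fun x => f x y) x₀ v) y₀ :=
    ((contMDiffAt_mderiv hf').clm_apply contMDiffAt_const).mdifferentiableAt (by simp)
  have m2 : MDifferentiableAt 𝓘(ℝ, E) 𝓘(ℝ, F) (fun x => mderiv E' F (f x) y₀ w) x₀ :=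
    ((contMDiffAt_mderiv hf).clm_apply contMDiffAt_const).mdifferentiableAt (by simp)
  rw [mderiv_eq_fderiv_chart m1, mderiv_eq_fderiv_chart m2]
  have hd : ∀ᶠ z in 𝓝 (x₀, y₀), ContMDiffAt (𝓘(ℝ, E).prod 𝓘(ℝ, E')) 𝓘(ℝ, F) 1
        (Function.uncurry f) z :=
    contMDiffAt_eventually hf
  have t1 : Tendsto (fun b => (x₀, (extChartAt 𝓘(ℝ, E') y₀).symm b))
      (𝓝 (extChartAt 𝓘(ℝ, E') y₀ y₀)) (𝓝 (x₀, y₀)) := by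
    have h := continuousAt_extChartAt_symm (I := 𝓘(ℝ, E')) y₀
    have h' : ContinuousAt (fun b => (x₀, (extChartAt 𝓘(ℝ, E') y₀).symm b))
      (extChartAt 𝓘(ℝ, E') y₀ y₀) := continuousAt_const.prodMk h
    simpa [ContinuousAt] using h'
  have t2 : Tendsto (fun a => ((extChartAt 𝓘(ℝ, E) x₀).symm a, y₀))
      (𝓝 (extChartAt 𝓘(ℝ, E) x₀ x₀)) (𝓝 (x₀, y₀)) := by
    have h := continuousAt_extChartAt_symm (I := 𝓘(ℝ, E)) x₀
    have h' : ContinuousAt (fun a => ((extChartAt 𝓘(ℝ, E) x₀).symm a, y₀))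
      (extChartAt 𝓘(ℝ, E) x₀ x₀) := h.prodMk continuousAt_const
    simpa [ContinuousAt] using h'
  -- `f` in both charts. The inner derivative is also a chart derivative because its base point,
  -- `x₀` or `y₀`, is the centre of the chart.
  let ψ : E × E' → F := fun p =>
    f ((extChartAt 𝓘(ℝ, E) x₀).symm p.1) ((extChartAt 𝓘(ℝ, E') y₀).symm p.2)
  have hψ : ContDiffAt ℝ 2 ψ (extChartAt 𝓘(ℝ, E) x₀ x₀, extChartAt 𝓘(ℝ, E') y₀ y₀) := by
    have := ((contMDiffAt_iff.1 hf).2).of_le (m := 2) ENat.LEInfty.out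
    simpa [ψ, Function.comp_def, Function.uncurry] using! this
  have e1 : ((fun y => mderiv E F (fun x => f x y) x₀ v) ∘ (extChartAt 𝓘(ℝ, E') y₀).symm)
      =ᶠ[𝓝 (extChartAt 𝓘(ℝ, E') y₀ y₀)]
      fun b => fderiv ℝ (fun a => ψ (a, b)) (extChartAt 𝓘(ℝ, E) x₀ x₀) v := by
    filter_upwards [t1.eventually hd] with b hb
    have := (hb.comp x₀ (f := fun x : M => (x, (extChartAt 𝓘(ℝ, E') y₀).symm b))
      (contMDiffAt_id.prodMk contMDiffAt_const)).mdifferentiableAt (by simp)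
    exact congrArg (fun L : E →L[ℝ] F => L v) (mderiv_eq_fderiv_chart this)
  have e2 : ((fun x => mderiv E' F (f x) y₀ w) ∘ (extChartAt 𝓘(ℝ, E) x₀).symm)
      =ᶠ[𝓝 (extChartAt 𝓘(ℝ, E) x₀ x₀)]
      fun a => fderiv ℝ (fun b => ψ (a, b)) (extChartAt 𝓘(ℝ, E') y₀ y₀) w := by
    filter_upwards [t2.eventually hd] with a ha
    have := (ha.comp y₀ (f := fun y : N => ((extChartAt 𝓘(ℝ, E) x₀).symm a, y))
      (contMDiffAt_const.prodMk contMDiffAt_id)).mdifferentiableAt (by simp)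
    exact congrArg (fun L : E' →L[ℝ] F => L w) (mderiv_eq_fderiv_chart this)
  rw [e1.fderiv_eq, e2.fderiv_eq]
  exact fderiv_fderiv_comm hψ v w

end MixedDerivatives

/-! ### Vector fields generated by families of maps, such as translations. -/

section FamilyFields

variable {E : Type*} [NormedAddCommGroup E] [NormedSpace ℝ E]
  {M : Type*} [TopologicalSpace M] [ChartedSpace E M]
  {E' : Type*} [NormedAddCommGroup E'] [NormedSpace ℝ E']
  {N : Type*} [TopologicalSpace N] [ChartedSpace E' N]

theorem contMDiffAt_family_chart [IsManifold 𝓘(ℝ, E) ∞ M]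
    {f : M → N → M} {y₀ : N} (hy : ∀ x, f x y₀ = x)
    (hf : ContMDiff (𝓘(ℝ, E).prod 𝓘(ℝ, E')) 𝓘(ℝ, E) ∞ (Function.uncurry f)) (g : M) :
    ContMDiffAt (𝓘(ℝ, E).prod 𝓘(ℝ, E')) 𝓘(ℝ, E) ∞
      (Function.uncurry fun x y => extChartAt 𝓘(ℝ, E) g (f x y)) (g, y₀) :=
  ContMDiffAt.comp_of_eq (contMDiffAt_extChartAt (I := 𝓘(ℝ, E)) (x := g)) (hf (g, y₀)) (hy g)

/-- The vector field generated by a family of maps `f x : N → M` with `f x y₀ = x` and a tangent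
vector at `y₀`, on charts. -/
theorem chartDerivative_family [IsManifold 𝓘(ℝ, E) ∞ M]
    {f : M → N → M} {y₀ : N} (hy : ∀ x, f x y₀ = x)
    (hf : ContMDiff (𝓘(ℝ, E).prod 𝓘(ℝ, E')) 𝓘(ℝ, E) ∞ (Function.uncurry f)) (v : E')
    {g x : M} (hx : x ∈ (chartAt E g).source) :
    chartDerivative g (fun x => mderiv E' E (f x) y₀ v) x =
      mderiv E' E (fun y => extChartAt 𝓘(ℝ, E) g (f x y)) y₀ v := by
  have h1 : MDifferentiableAt 𝓘(ℝ, E') 𝓘(ℝ, E) (f x) y₀ :=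
    (ContMDiff.comp hf (contMDiff_const.prodMk contMDiff_id)).mdifferentiableAt (by simp)
  exact (mderiv_comp_apply (hy x) (mdifferentiableAt_extChartAt hx) h1 v).symm

theorem contMDiff_family [IsManifold 𝓘(ℝ, E) ∞ M] [IsManifold 𝓘(ℝ, E') ∞ N]
    {f : M → N → M} {y₀ : N} (hy : ∀ x, f x y₀ = x)
    (hf : ContMDiff (𝓘(ℝ, E).prod 𝓘(ℝ, E')) 𝓘(ℝ, E) ∞ (Function.uncurry f)) (v : E') :
    ContMDiff 𝓘(ℝ, E) (𝓘(ℝ, E).prod 𝓘(ℝ, E)) ∞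
      (tangentSection fun x => mderiv E' E (f x) y₀ v) := by
  intro g
  refine (contMDiffAt_section (E := TangentSpace 𝓘(ℝ, E)) (IB := 𝓘(ℝ, E)) g).2 ?_
  refine ((contMDiffAt_mderiv (contMDiffAt_family_chart hy hf g)).clm_apply
    (contMDiffAt_const (c := v))).congr_of_eventuallyEq ?_
  filter_upwards [(chartAt E g).open_source.mem_nhds (mem_chart_source E g)] with x hx
  rw [← chartDerivative_family hy hf v hx]
  exact (chartDerivative_eq_trivializationAt (fun x => mderiv E' E (f x) y₀ v) hx).symm

end FamilyFields

/-! ### Invariant vector fields and the adjoint action of a Lie group. -/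

section LieGroups

variable {E : Type*} [NormedAddCommGroup E] [NormedSpace ℝ E]
  {G : Type*} [TopologicalSpace G] [ChartedSpace E G] [Group G]

/-- `(L_g)_* X`, in the model space. -/
def leftVec (X : E) (g : G) : E := mderiv E E (fun h : G => g * h) 1 X

/-- `(R_g)_* X`, in the model space. -/
def rightVec (X : E) (g : G) : E := mderiv E E (fun h : G => h * g) 1 X

/-- The adjoint action on the model space. -/
def adL (g : G) : E →L[ℝ] E := mderiv E E (fun h : G => g * h * g⁻¹) 1

variable (G) in
/-- The Lie bracket of `Lie(G)` on the model space. -/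
def lieBr (X Y : E) : E := Bracket.bracket (L := LieAlg E G) (M := LieAlg E G) X Y

theorem leftVec_one (X : E) : leftVec X (1 : G) = X := by
  simp only [leftVec, one_mul, mderiv_id, ContinuousLinearMap.id_apply]

theorem rightVec_one (X : E) : rightVec X (1 : G) = X := by
  simp only [rightVec, mul_one, mderiv_id, ContinuousLinearMap.id_apply]

variable [LieGroup 𝓘(ℝ, E) ∞ G]

theorem mdifferentiableAt_mul_left (g h : G) :
    MDifferentiableAt 𝓘(ℝ, E) 𝓘(ℝ, E) (fun k : G => g * k) h :=
  (contMDiff_mul_left (I := 𝓘(ℝ, E)) (n := ∞)).mdifferentiableAt (by simp)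

theorem mdifferentiableAt_mul_right (g h : G) :
    MDifferentiableAt 𝓘(ℝ, E) 𝓘(ℝ, E) (fun k : G => k * g) h :=
  (contMDiff_mul_right (I := 𝓘(ℝ, E)) (n := ∞)).mdifferentiableAt (by simp)

theorem contMDiff_uncurry_mul :
    ContMDiff (𝓘(ℝ, E).prod 𝓘(ℝ, E)) 𝓘(ℝ, E) ∞ (Function.uncurry fun g h : G => g * h) :=
  contMDiff_mul 𝓘(ℝ, E) ∞

theorem contMDiff_uncurry_mul_swap :
    ContMDiff (𝓘(ℝ, E).prod 𝓘(ℝ, E)) 𝓘(ℝ, E) ∞ (Function.uncurry fun g h : G => h * g) :=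
  contMDiff_snd.mul contMDiff_fst

theorem contMDiff_leftVec (X : E) :
    ContMDiff 𝓘(ℝ, E) (𝓘(ℝ, E).prod 𝓘(ℝ, E)) ∞ (tangentSection (leftVec X : G → E)) :=
  contMDiff_family mul_one contMDiff_uncurry_mul X

theorem contMDiff_rightVec (X : E) :
    ContMDiff 𝓘(ℝ, E) (𝓘(ℝ, E).prod 𝓘(ℝ, E)) ∞ (tangentSection (rightVec X : G → E)) :=
  contMDiff_family one_mul contMDiff_uncurry_mul_swap X

theorem mdifferentiableAt_chartDerivative_leftVec (g : G) (X : E) :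
    MDifferentiableAt 𝓘(ℝ, E) 𝓘(ℝ, E) (chartDerivative g (leftVec X)) g :=
  mdifferentiableAt_chartDerivative ((contMDiff_leftVec X).mdifferentiableAt (by simp))

theorem mdifferentiableAt_chartDerivative_rightVec (g : G) (W : E) :
    MDifferentiableAt 𝓘(ℝ, E) 𝓘(ℝ, E) (chartDerivative g (rightVec W)) g :=
  mdifferentiableAt_chartDerivative ((contMDiff_rightVec W).mdifferentiableAt (by simp))

/-- Left- and right-invariant vector fields commute, on charts. -/
theorem mderiv_chartDerivative_left_right (g : G) (X W : E) :
    mderiv E E (chartDerivative g (rightVec W)) g (leftVec X g) =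
      mderiv E E (chartDerivative g (leftVec X)) g (rightVec W g) := by
  have hs := (chartAt E g).open_source.mem_nhds (mem_chart_source E g)
  -- By associativity both sides are mixed partial derivatives at `(1, 1)` of the single map `(h, k)
  -- ↦ h g k`, read in the chart at `g`.
  have hF : ContMDiffAt (𝓘(ℝ, E).prod 𝓘(ℝ, E)) 𝓘(ℝ, E) ∞
      (Function.uncurry fun h k : G => extChartAt 𝓘(ℝ, E) g (h * g * k)) (1, 1) :=
    ContMDiffAt.comp_of_eq (contMDiffAt_extChartAt (I := 𝓘(ℝ, E)) (x := g))
      ((contMDiff_fst.mul contMDiff_const).mul contMDiff_snd).contMDiffAt (by simp)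
  have e1 : mderiv E E (chartDerivative g (rightVec W)) g (leftVec X g) =
      mderiv E E (fun k : G => chartDerivative g (rightVec W) (g * k)) 1 X :=
    (mderiv_comp_apply (mul_one g) (mdifferentiableAt_chartDerivative_rightVec g W)
      (mdifferentiableAt_mul_left g 1) X).symm
  have e2 : mderiv E E (chartDerivative g (leftVec X)) g (rightVec W g) =
      mderiv E E (fun h : G => chartDerivative g (leftVec X) (h * g)) 1 W :=
    (mderiv_comp_apply (f := fun h : G => h * g) (one_mul g)
      (mdifferentiableAt_chartDerivative_leftVec g X) (mdifferentiableAt_mul_right g 1) W).symm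
  have c1 : (fun k : G => chartDerivative g (rightVec W) (g * k)) =ᶠ[𝓝 1]
      fun k => mderiv E E (fun h : G => extChartAt 𝓘(ℝ, E) g (h * g * k)) 1 W := by
    have ht : Tendsto (fun k : G => g * k) (𝓝 1) (𝓝 g) := by
      simpa using ((mdifferentiableAt_mul_left (E := E) g 1).continuousAt).tendsto
    filter_upwards [ht.eventually hs] with k hk
    refine (chartDerivative_family one_mul contMDiff_uncurry_mul_swap W hk).trans ?_
    simp only [mul_assoc]
  have c2 : (fun h : G => chartDerivative g (leftVec X) (h * g)) =ᶠ[𝓝 1]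
      fun h => mderiv E E (fun k : G => extChartAt 𝓘(ℝ, E) g (h * g * k)) 1 X := by
    have ht : Tendsto (fun h : G => h * g) (𝓝 1) (𝓝 g) := by
      simpa using ((mdifferentiableAt_mul_right (E := E) g 1).continuousAt).tendsto
    filter_upwards [ht.eventually hs] with h hh
    exact chartDerivative_family mul_one contMDiff_uncurry_mul X hh
  rw [e1, e2, mderiv_congr c1, mderiv_congr c2]
  exact mderiv_mderiv_comm hF W X

theorem vectorBracket_leftVec_rightVec (X W : E) (g : G) :
    vectorBracket (leftVec X) (rightVec W) g = 0 := by
  rw [mlieBracket_eq_mderiv_chartDerivative (mdifferentiableAt_chartDerivative_leftVec g X)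
    (mdifferentiableAt_chartDerivative_rightVec g W),
    mderiv_chartDerivative_left_right, sub_self]

theorem vectorBracket_leftVec [CompleteSpace E] (X Y : E) (g : G) :
    vectorBracket (leftVec X) (leftVec Y) g = leftVec (lieBr G X Y) g :=
  (congrFun (mulInvariantVector_mlieBracket (I := 𝓘(ℝ, E)) (G := G) X Y) g).symm

theorem mdifferentiableAt_conj (g h : G) :
    MDifferentiableAt 𝓘(ℝ, E) 𝓘(ℝ, E) (fun k : G => g * k * g⁻¹) h :=
  ((contMDiff_mul_right (I := 𝓘(ℝ, E)) (n := ∞)).comp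
    (contMDiff_mul_left (I := 𝓘(ℝ, E)) (n := ∞))).mdifferentiableAt (by simp)

omit [LieGroup 𝓘(ℝ, E) ∞ G] in
theorem adL_one (X : E) : adL (1 : G) X = X := by
  simp only [adL, one_mul, inv_one, mul_one, mderiv_id, ContinuousLinearMap.id_apply]

theorem adL_mul (g h : G) (X : E) : adL (g * h) X = adL g (adL h X) := by
  have := mderiv_comp_apply (E := E) (E' := E) (E'' := E) (g := fun k : G => g * k * g⁻¹)
    (f := fun k : G => h * k * h⁻¹) (x := 1) (y := 1) (by simp)
    (mdifferentiableAt_conj g 1) (mdifferentiableAt_conj h 1) X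
  rw [adL, adL, adL, ← this]
  simp only [mul_inv_rev, mul_assoc]

theorem adL_adL_inv (g : G) (X : E) : adL g (adL g⁻¹ X) = X := by
  rw [← adL_mul, mul_inv_cancel, adL_one]

/-- `(L_g)_* X = (R_g)_* Ad_g X`. -/
theorem leftVec_eq_rightVec (g : G) (X : E) : leftVec X g = rightVec (adL g X) g := by
  have := mderiv_comp_apply (E := E) (E' := E) (E'' := E) (g := fun k : G => k * g)
    (f := fun k : G => g * k * g⁻¹) (x := 1) (y := 1) (by simp)
    (mdifferentiableAt_mul_right g 1) (mdifferentiableAt_conj g 1) X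
  refine Eq.trans ?_ this
  simp only [inv_mul_cancel_right]
  rfl

theorem rightVec_eq_leftVec (g : G) (X : E) : rightVec X g = leftVec (adL g⁻¹ X) g := by
  rw [leftVec_eq_rightVec, adL_adL_inv]

theorem contMDiff_adL : ContMDiff 𝓘(ℝ, E) 𝓘(ℝ, E →L[ℝ] E) ∞ (adL : G → E →L[ℝ] E) := by
  intro g
  refine contMDiffAt_mderiv_of_fixed (fun x => by simp) ?_
  exact ((contMDiff_fst.mul contMDiff_snd).mul
    (contMDiff_inv 𝓘(ℝ, E) ∞ |>.comp contMDiff_fst)).contMDiffAt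

theorem mdifferentiableAt_adL_apply (Y : E) (g : G) :
    MDifferentiableAt 𝓘(ℝ, E) 𝓘(ℝ, E) (fun k : G => adL k Y) g :=
  (contMDiff_adL.clm_apply contMDiff_const).mdifferentiableAt (by simp)

/-- The derivative at the identity of the adjoint action is the Lie bracket. -/
theorem mderiv_adL_one [CompleteSpace E] (X Y : E) :
    mderiv E E (fun k : G => adL k Y) 1 X = lieBr G X Y := by
  have hs := (chartAt E (1 : G)).open_source.mem_nhds (mem_chart_source E 1)
  -- `D k Z` is the right-invariant field of `Z` in the chart at `1`. Hence the left-invariant field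
  -- of `Y` reads `D k (Ad_k Y)`.
  let D : G → E →L[ℝ] E := fun k => mderiv E E (fun h : G => extChartAt 𝓘(ℝ, E) (1 : G) (h * k)) 1
  have hD : MDifferentiableAt 𝓘(ℝ, E) 𝓘(ℝ, E →L[ℝ] E) D 1 :=
    (contMDiffAt_mderiv (contMDiffAt_family_chart (g := (1 : G)) one_mul
      contMDiff_uncurry_mul_swap)).mdifferentiableAt (by simp)
  have hD1 : D 1 = ContinuousLinearMap.id ℝ E := by
    simp only [D, mul_one]
    exact mderiv_extChartAt_self 1
  have cR (Z : E) {k : G} (hk : k ∈ (chartAt E (1 : G)).source) :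
      chartDerivative 1 (rightVec Z) k = D k Z :=
    chartDerivative_family one_mul contMDiff_uncurry_mul_swap Z hk
  have c1 : chartDerivative 1 (rightVec Y) =ᶠ[𝓝 (1 : G)] fun k => D k Y := by
    filter_upwards [hs] with k hk using cR Y hk
  have c2 : chartDerivative 1 (leftVec Y) =ᶠ[𝓝 (1 : G)] fun k => D k (adL k Y) := by
    filter_upwards [hs] with k hk
    rw [← cR (adL k Y) hk, chartDerivative, chartDerivative, leftVec_eq_rightVec]
  -- The bracket formula has the derivative of the left field of `X` along `Y` as its second term.
  -- Commutation of left and right fields replaces it by the derivative of the right field of `Y`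
  -- along `X`. The product rule then cancels the derivatives of `D` and leaves that of `Ad`.
  have hb : lieBr G X Y = mderiv E E (fun k => D k (adL k Y)) (1 : G) X -
      mderiv E E (fun k => D k Y) (1 : G) X := by
    have h0 : lieBr G X Y = vectorBracket (leftVec X) (leftVec Y) (1 : G) := by
      rw [vectorBracket_leftVec, leftVec_one]
    rw [h0, mlieBracket_eq_mderiv_chartDerivative (mdifferentiableAt_chartDerivative_leftVec 1 X)
      (mdifferentiableAt_chartDerivative_leftVec 1 Y), mderiv_congr c2, ← mderiv_congr c1]
    have := mderiv_chartDerivative_left_right (1 : G) X Y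
    simp only [leftVec_one, rightVec_one] at this ⊢
    rw [this]
  have hAd := mdifferentiableAt_adL_apply Y (1 : G)
  have hA := hasFDerivAt_comp_chart_symm hAd
  have hDD := hasFDerivAt_comp_chart_symm hD
  have d1 := hDD.clm_apply hA
  have d2 := hDD.clm_apply (hasFDerivAt_const Y (extChartAt 𝓘(ℝ, E) (1 : G) 1))
  have m1 := mderiv_eq_fderiv_chart (hD.clm_apply hAd)
  have m2 := mderiv_eq_fderiv_chart (hD.clm_apply (mdifferentiableAt_const (c := Y)))
  have m1' := m1.trans d1.fderiv
  have m2' := m2.trans d2.fderiv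
  rw [hb, m1', m2']
  simp [hD1, adL_one]

/-- `Ad_{gk} = Ad_g Ad_k` with `Ad_g` linear reduces the derivative at `g` to the one at the
identity. -/
theorem mderiv_adL [CompleteSpace E] (X Y : E) (g : G) :
    mderiv E E (fun k : G => adL k Y) g (leftVec X g) = adL g (lieBr G X Y) := by
  have h1 : mderiv E E (fun k : G => adL k Y) g (leftVec X g) =
      mderiv E E (fun k : G => adL (g * k) Y) 1 X :=
    (mderiv_comp_apply (mul_one g) (mdifferentiableAt_adL_apply Y g)
      (mdifferentiableAt_mul_left g 1) X).symm
  have h2 : (fun k : G => adL (g * k) Y) = fun k => adL g (adL k Y) :=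
    funext fun k => adL_mul g k Y
  rw [h1, h2, mderiv_comp_apply (E' := E) (g := adL g) (f := fun k : G => adL k Y) rfl
    (adL g).differentiableAt.mdifferentiableAt
    (mdifferentiableAt_adL_apply Y 1), mderiv_eq_fderiv, (adL g).fderiv, mderiv_adL_one]

/-- The adjoint action is by Lie algebra homomorphisms. -/
theorem adL_lieBr [CompleteSpace E] (g : G) (X Y : E) :
    adL g (lieBr G X Y) = lieBr G (adL g X) (adL g Y) := by
  have hc (h : G) : MDifferentiableAt 𝓘(ℝ, E) 𝓘(ℝ, E) (fun k : G => g * k * g⁻¹) h :=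
    mdifferentiableAt_conj g h
  have hc' (h : G) : MDifferentiableAt 𝓘(ℝ, E) 𝓘(ℝ, E) (fun k : G => g⁻¹ * k * g) h := by
    simpa using mdifferentiableAt_conj (E := E) g⁻¹ h
  have hinv (h : G) : ContinuousLinearMap.inverse
      (mderiv E E (fun k : G => g * k * g⁻¹) h) =
      mderiv E E (fun k : G => g⁻¹ * k * g) (g * h * g⁻¹) := by
    apply ContinuousLinearMap.inverse_eq
    · ext v
      have := mderiv_comp_apply (E := E) (f := fun k : G => g⁻¹ * k * g)
        (x := g * h * g⁻¹) (y := h) (by group) (hc h) (hc' _) v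
      refine this.symm.trans ?_
      have e : (fun z : G => g * (g⁻¹ * z * g) * g⁻¹) = fun z => z := by
        funext z; group
      rw [e, mderiv_id]
    · ext v
      have := mderiv_comp_apply (E := E) (f := fun k : G => g * k * g⁻¹)
        (x := h) rfl (hc' _) (hc h) v
      refine this.symm.trans ?_
      have e : (fun z : G => g⁻¹ * (g * z * g⁻¹) * g) = fun z => z := by
        funext z; group
      rw [e, mderiv_id]
  -- Conjugation by `g` carries the left-invariant field of `Z` to that of `Ad_g Z`. Naturality of
  -- the Lie bracket under pullback, evaluated at `1`, then gives the claim.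
  have hpull (Z : E) (h : G) : (mderiv E E (fun k : G => g * k * g⁻¹) h).inverse
      (leftVec (adL g Z) (g * h * g⁻¹)) = leftVec Z h := by
    rw [hinv]
    have a1 := mderiv_comp_apply (E := E) (E' := E) (g := fun k : G => g * h * g⁻¹ * k)
      (f := fun k : G => g * k * g⁻¹) (x := 1) (y := 1) (by simp)
      (mdifferentiableAt_mul_left _ 1) (hc 1) Z
    have a2 := mderiv_comp_apply (E := E) (E' := E) (g := fun k : G => g⁻¹ * k * g)
      (f := fun k : G => g * h * g⁻¹ * (g * k * g⁻¹)) (x := 1) (y := g * h * g⁻¹) (by simp)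
      (hc' _) ((mdifferentiableAt_mul_left _ _).comp 1 (hc 1)) Z
    rw [a1] at a2
    refine a2.symm.trans ?_
    rw [leftVec]
    congr 2
    funext z
    group
  have hP : mpullback 𝓘(ℝ, E) 𝓘(ℝ, E) (fun k : G => g * k * g⁻¹)
        (mlieBracket 𝓘(ℝ, E) (leftVec (adL g X)) (leftVec (adL g Y))) 1 =
      mlieBracket 𝓘(ℝ, E)
        (mpullback 𝓘(ℝ, E) 𝓘(ℝ, E) (fun k : G => g * k * g⁻¹) (leftVec (adL g X)))
        (mpullback 𝓘(ℝ, E) 𝓘(ℝ, E) (fun k : G => g * k * g⁻¹) (leftVec (adL g Y))) 1 :=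
    mpullback_mlieBracket (n := 2)
      ((contMDiff_leftVec (adL g X)).mdifferentiableAt (by simp))
      ((contMDiff_leftVec (adL g Y)).mdifferentiableAt (by simp))
      (((contMDiff_mul_right (I := 𝓘(ℝ, E)) (n := ∞)).comp
        (contMDiff_mul_left (I := 𝓘(ℝ, E)) (n := ∞))).contMDiffAt.of_le ENat.LEInfty.out)
      (by simp)
  have hX : mpullback 𝓘(ℝ, E) 𝓘(ℝ, E) (fun k : G => g * k * g⁻¹) (leftVec (adL g X)) =
      leftVec X := funext fun h => hpull X h
  have hY : mpullback 𝓘(ℝ, E) 𝓘(ℝ, E) (fun k : G => g * k * g⁻¹) (leftVec (adL g Y)) =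
      leftVec Y := funext fun h => hpull Y h
  rw [hX, hY] at hP
  have hP' : (mderiv E E (fun k : G => g * k * g⁻¹) 1).inverse
      (vectorBracket (leftVec (adL g X)) (leftVec (adL g Y)) (g * 1 * g⁻¹)) =
      vectorBracket (leftVec X) (leftVec Y) (1 : G) := hP
  rw [vectorBracket_leftVec, vectorBracket_leftVec, leftVec_one, hinv] at hP'
  rw [← hP']
  simp only [mul_one, mul_inv_cancel, leftVec_one]
  have : (adL g⁻¹ : E →L[ℝ] E) = mderiv E E (fun k : G => g⁻¹ * k * g) 1 := by
    simp [adL]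
  rw [← this, adL_adL_inv]

end LieGroups

/-! ### Constancy from zero derivative, and local sections of submersions. -/

section Manifolds

variable {E : Type*} [NormedAddCommGroup E] [NormedSpace ℝ E]
  {M : Type*} [TopologicalSpace M] [ChartedSpace E M] [IsManifold 𝓘(ℝ, E) ∞ M]
  {E' : Type*} [NormedAddCommGroup E'] [NormedSpace ℝ E']
  {N : Type*} [TopologicalSpace N] [ChartedSpace E' N] [IsManifold 𝓘(ℝ, E') ∞ N]
  {F : Type*} [NormedAddCommGroup F] [NormedSpace ℝ F]

/-- A function with zero derivative on a connected manifold is constant. -/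
theorem eq_of_mderiv_eq_zero [PreconnectedSpace M] {u : M → F}
    (hu : MDifferentiable 𝓘(ℝ, E) 𝓘(ℝ, F) u) (h0 : ∀ x, mderiv E F u x = 0) (x y : M) :
    u x = u y := by
  have hl : IsLocallyConstant u := by
    rw [IsLocallyConstant.iff_eventually_eq]
    intro x
    -- A ball inside the chart target is connected, so the vector-space version applies on it.
    obtain ⟨r, hr, hB⟩ := Metric.mem_nhds_iff.1 (extChartAt_target_mem_nhds (I := 𝓘(ℝ, E)) x)
    have hsrc := extChartAt_source_mem_nhds (I := 𝓘(ℝ, E)) x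
    have hball := (continuousAt_extChartAt (I := 𝓘(ℝ, E)) x).preimage_mem_nhds
      (Metric.ball_mem_nhds _ hr)
    have hd : ∀ z ∈ Metric.ball (extChartAt 𝓘(ℝ, E) x x) r,
        HasFDerivAt (u ∘ (extChartAt 𝓘(ℝ, E) x).symm) (0 : E →L[ℝ] F) z := by
      intro z hz
      have h1 : MDifferentiableAt 𝓘(ℝ, E) 𝓘(ℝ, E) (extChartAt 𝓘(ℝ, E) x).symm z := by
        have := mdifferentiableWithinAt_extChartAt_symm (I := 𝓘(ℝ, E)) (hB hz)
        rw [modelWithCornersSelf_coe, Set.range_id] at this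
        exact mdifferentiableWithinAt_univ.1 this
      have h2 := mderiv_comp (hu ((extChartAt 𝓘(ℝ, E) x).symm z)) h1
      rw [h0, ContinuousLinearMap.zero_comp, mderiv_eq_fderiv] at h2
      rw [← h2]
      exact ((hu _).comp z h1).differentiableAt.hasFDerivAt
    filter_upwards [hsrc, hball] with y hy hy'
    have := Metric.isOpen_ball.is_const_of_fderiv_eq_zero (𝕜 := ℝ)
      (convex_ball (extChartAt 𝓘(ℝ, E) x x) r).isPreconnected
      (fun z hz => (hd z hz).differentiableAt.differentiableWithinAt)
      (fun z hz => (hd z hz).fderiv) hy' (Metric.mem_ball_self hr)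
    rwa [Function.comp_apply, Function.comp_apply, extChartAt_to_inv,
      (extChartAt 𝓘(ℝ, E) x).left_inv hy] at this
  exact hl.apply_eq_of_isPreconnected isPreconnected_univ trivial trivial

/-- A smooth map whose derivative at a point has a right inverse has a smooth local section. -/
theorem exists_local_section [CompleteSpace E'] {ρ : M → N} {k : M}
    (hρ : ContMDiffAt 𝓘(ℝ, E) 𝓘(ℝ, E') ∞ ρ k) (A : E' →L[ℝ] E)
    (hA : ∀ w, mderiv E E' ρ k (A w) = w) :
    ∃ s : N → M, ContMDiffAt 𝓘(ℝ, E') 𝓘(ℝ, E) ∞ s (ρ k) ∧ s (ρ k) = k ∧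
      ∀ᶠ g in 𝓝 (ρ k), ρ (s g) = g := by
  let u : M → E' := fun x => extChartAt 𝓘(ℝ, E') (ρ k) (ρ x)
  have hu : ContMDiffAt 𝓘(ℝ, E) 𝓘(ℝ, E') ∞ u k :=
    (contMDiffAt_extChartAt (I := 𝓘(ℝ, E')) (x := ρ k)).comp k hρ
  have hu' : ContDiffAt ℝ ∞ (u ∘ (extChartAt 𝓘(ℝ, E) k).symm) (extChartAt 𝓘(ℝ, E) k k) := by
    have := (contMDiffAt_iff.1 hu).2
    simpa [Function.comp_def] using! this
  have hdu : mderiv E E' u k = mderiv E E' ρ k := by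
    ext v
    rw [mderiv_comp_apply (E' := E') (f := ρ) rfl
      ((contMDiffAt_extChartAt (I := 𝓘(ℝ, E')) (x := ρ k)).mdifferentiableAt (n := ∞) (by simp))
      (hρ.mdifferentiableAt (by simp)), mderiv_extChartAt_self, ContinuousLinearMap.id_apply]
  let aff : E' → E := fun a => extChartAt 𝓘(ℝ, E) k k + A a
  have haff : ContDiff ℝ ∞ aff := contDiff_const.add A.contDiff
  have haff0 : aff 0 = extChartAt 𝓘(ℝ, E) k k := by simp [aff]
  -- Restricting `ρ` to the affine slice through `k` in the direction of `A` gives a map with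
  -- identity derivative at `0`. Its local inverse exists by the inverse function theorem and
  -- provides the section.
  let Ψ : E' → E' := (u ∘ (extChartAt 𝓘(ℝ, E) k).symm) ∘ aff
  have hΨ : ContDiffAt ℝ ∞ Ψ 0 := by
    refine ContDiffAt.comp 0 ?_ haff.contDiffAt
    rw [haff0]
    exact hu'
  have hΨ' : HasFDerivAt Ψ ((ContinuousLinearEquiv.refl ℝ E' : E' ≃L[ℝ] E') : E' →L[ℝ] E') 0 := by
    have h1 := hasFDerivAt_comp_chart_symm (hu.mdifferentiableAt (by simp))
    rw [← haff0] at h1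
    have h2 : HasFDerivAt aff A 0 := A.hasFDerivAt.const_add _
    refine (h1.comp 0 h2).congr_fderiv ?_
    ext w
    simp [hdu, hA]
  have hn : (∞ : WithTop ℕ∞) ≠ 0 := by simp
  let e : E' → E' := hΨ.localInverse hΨ' hn
  have hΨ0 : Ψ 0 = extChartAt 𝓘(ℝ, E') (ρ k) (ρ k) := by
    simp [Ψ, haff0, u]
  have he0 : e (extChartAt 𝓘(ℝ, E') (ρ k) (ρ k)) = 0 := by
    rw [← hΨ0]
    exact hΨ.localInverse_apply_image hΨ' hn
  have he : ContDiffAt ℝ ∞ e (extChartAt 𝓘(ℝ, E') (ρ k) (ρ k)) := by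
    rw [← hΨ0]
    exact hΨ.to_localInverse hΨ' hn
  have her : ∀ᶠ y in 𝓝 (extChartAt 𝓘(ℝ, E') (ρ k) (ρ k)), Ψ (e y) = y := by
    rw [← hΨ0]
    exact (hΨ.hasStrictFDerivAt' hΨ' hn).eventually_right_inverse
  let s : N → M := fun g => (extChartAt 𝓘(ℝ, E) k).symm (aff (e (extChartAt 𝓘(ℝ, E') (ρ k) g)))
  have hs0 : s (ρ k) = k := by
    simp only [s, he0, haff0, extChartAt_to_inv]
  have hs : ContMDiffAt 𝓘(ℝ, E') 𝓘(ℝ, E) ∞ s (ρ k) := by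
    have h1 : ContMDiffAt 𝓘(ℝ, E) 𝓘(ℝ, E) ∞ (extChartAt 𝓘(ℝ, E) k).symm
        (extChartAt 𝓘(ℝ, E) k k) :=
      (contMDiffOn_extChartAt_symm k).contMDiffAt (extChartAt_target_mem_nhds k)
    have h2 : ContMDiffAt 𝓘(ℝ, E') 𝓘(ℝ, E') ∞ (extChartAt 𝓘(ℝ, E') (ρ k)) (ρ k) :=
      contMDiffAt_extChartAt
    have h3 : ContMDiffAt 𝓘(ℝ, E') 𝓘(ℝ, E) ∞ (fun y => aff (e y))
        (extChartAt 𝓘(ℝ, E') (ρ k) (ρ k)) :=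
      (haff.contDiffAt.comp _ he).contMDiffAt
    have h4 : ContMDiffAt 𝓘(ℝ, E') 𝓘(ℝ, E) ∞
        (fun g => aff (e (extChartAt 𝓘(ℝ, E') (ρ k) g))) (ρ k) :=
      ContMDiffAt.comp (g := fun y => aff (e y)) (ρ k) h3 h2
    exact ContMDiffAt.comp_of_eq h1 h4 (by rw [he0, haff0])
  refine ⟨s, hs, hs0, ?_⟩
  have c1 : ∀ᶠ g in 𝓝 (ρ k), Ψ (e (extChartAt 𝓘(ℝ, E') (ρ k) g)) =
      extChartAt 𝓘(ℝ, E') (ρ k) g :=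
    (continuousAt_extChartAt (I := 𝓘(ℝ, E')) (ρ k)).eventually her
  have hsrc := extChartAt_source_mem_nhds (I := 𝓘(ℝ, E')) (ρ k)
  -- The equation for `Ψ` only compares chart values; injectivity of the chart needs `ρ (s g)` as
  -- well as `g` in its source.
  have c2 : ∀ᶠ g in 𝓝 (ρ k), ρ (s g) ∈ (extChartAt 𝓘(ℝ, E') (ρ k)).source := by
    have : ContinuousAt (fun g => ρ (s g)) (ρ k) :=
      ContinuousAt.comp_of_eq hρ.continuousAt hs.continuousAt hs0
    refine this.preimage_mem_nhds ?_
    simpa only [hs0] using hsrc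
  filter_upwards [c1, c2, hsrc] with g h1 h2 h3
  exact (extChartAt 𝓘(ℝ, E') (ρ k)).injOn h2 h3 h1

end Manifolds

section LieGroups

variable {E : Type*} [NormedAddCommGroup E] [NormedSpace ℝ E]
  {G : Type*} [TopologicalSpace G] [ChartedSpace E G] [Group G] [LieGroup 𝓘(ℝ, E) ∞ G]

theorem leftVec_surjective (k : G) (v : E) : ∃ V, leftVec V k = v := by
  refine ⟨mderiv E E (fun l : G => k⁻¹ * l) k v, ?_⟩
  have := mderiv_comp_apply (E := E) (E' := E) (g := fun l : G => k * l)
    (f := fun l : G => k⁻¹ * l) (x := k) (y := 1) (by simp)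
    (mdifferentiableAt_mul_left k 1) (mdifferentiableAt_mul_left k⁻¹ k) v
  rw [leftVec, ← this]
  simp only [mul_inv_cancel_left, mderiv_id, ContinuousLinearMap.id_apply]

end LieGroups

/-! ### The central extension: its bracket, its adjoint action and the cochain `f`. -/

section CentralExtensions

variable {E : Type*} [NormedAddCommGroup E] [NormedSpace ℝ E] [CompleteSpace E]
  {G : Type*} [TopologicalSpace G] [ChartedSpace E G] [Group G] [LieGroup 𝓘(ℝ, E) ∞ G]

/-- A 2-cocycle as a function on the model space. -/
def Cocycle.bil (F : Cocycle E G) (X Y : E) : ℝ := F.form (X : LieAlg E G) (Y : LieAlg E G)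

theorem Cocycle.bil_self (F : Cocycle E G) (X : E) : F.bil X X = 0 :=
  (congrArg (TrivialLieModule.equiv ℝ (LieAlg E G) ℝ) (F.1.2 X)).trans (map_zero _)

theorem Cocycle.bil_add_left (F : Cocycle E G) (X Y Z : E) :
    F.bil (X + Y) Z = F.bil X Z + F.bil Y Z :=
  congrArg (fun L => L Z) (F.form.map_add X Y)

theorem Cocycle.bil_add_right (F : Cocycle E G) (X Y Z : E) :
    F.bil X (Y + Z) = F.bil X Y + F.bil X Z :=
  (F.form X).map_add Y Z

theorem Cocycle.bil_swap (F : Cocycle E G) (X Y : E) : F.bil X Y = -F.bil Y X := by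
  have h := F.bil_self (X + Y)
  rw [F.bil_add_left, F.bil_add_right, F.bil_add_right, F.bil_self, F.bil_self] at h
  linarith

theorem CentralExt.mk_add (F : Cocycle E G) (X Y : LieAlg E G) (s t : ℝ) :
    CentralExt.mk F (X + Y) (s + t) = CentralExt.mk F X s + CentralExt.mk F Y t := rfl

theorem CentralExt.mk_smul (F : Cocycle E G) (r : ℝ) (X : LieAlg E G) (s : ℝ) :
    CentralExt.mk F (r • X) (r * s) = r • CentralExt.mk F X s := rfl

theorem CentralExt.mk_eq_add (F : Cocycle E G) (X : LieAlg E G) (s : ℝ) :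
    CentralExt.mk F X s = CentralExt.mk F X 0 + s • CentralExt.mk F 0 1 := by
  rw [← CentralExt.mk_smul, ← CentralExt.mk_add]
  simp

theorem CentralExt.coeff_mk (F : Cocycle E G) (X : LieAlg E G) (s : ℝ) :
    CentralExt.coeff F (CentralExt.mk F X s) = s := rfl

theorem CentralExt.exists_eq_mk (F : Cocycle E G) (a : CentralExt F) :
    ∃ X s, a = CentralExt.mk F X s := ⟨_, _, rfl⟩

theorem CentralExt.lie_mk (F : Cocycle E G) (X Y : LieAlg E G) (s t : ℝ) :
    ⁅CentralExt.mk F X s, CentralExt.mk F Y t⁆ = CentralExt.mk F ⁅X, Y⁆ (F.form X Y) := by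
  rw [LieAlgebra.bracket_ofTwoCocycle]
  simp only [CentralExt.mk, Equiv.symm_apply_apply, trivial_lie_zero, add_zero, sub_zero]
  rfl

variable {E' : Type*} [NormedAddCommGroup E'] [NormedSpace ℝ E'] [CompleteSpace E']
  {G' : Type*} [TopologicalSpace G'] [ChartedSpace E' G'] [Group G'] [LieGroup 𝓘(ℝ, E') ∞ G']
  (F : Cocycle E G) (ρ : G' →* G) (Φ : CentralExt F ≃ₗ⁅ℝ⁆ LieAlg E' G')

/-- The vector `X + sZ` in the model space of the extension. -/
def lift (X : E) (s : ℝ) : E' := Φ (CentralExt.mk F X s)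

theorem lift_eq_add (X : E) (s : ℝ) : lift F Φ X s = lift F Φ X 0 + s • lift F Φ 0 1 :=
  (congrArg Φ (CentralExt.mk_eq_add F X s)).trans
    ((map_add Φ _ _).trans (congrArg _ (map_smul Φ s _)))

theorem lieBr_lift (X Y : E) (s t : ℝ) :
    lieBr G' (lift F Φ X s) (lift F Φ Y t) = lift F Φ (lieBr G X Y) (F.bil X Y) :=
  (LieHom.map_lie (Φ : CentralExt F →ₗ⁅ℝ⁆ LieAlg E' G') (CentralExt.mk F X s)
    (CentralExt.mk F Y t)).symm.trans (congrArg Φ (CentralExt.lie_mk F X Y s t))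

theorem exists_eq_lift (V : E') : ∃ (X : E) (s : ℝ), V = lift F Φ X s := by
  obtain ⟨a, ha⟩ := Φ.surjective V
  obtain ⟨X, s, rfl⟩ := CentralExt.exists_eq_mk F a
  exact ⟨X, s, ha.symm⟩

/-- The coefficient of `Z`, on the model space of the extension. -/
def liftCoeff [FiniteDimensional ℝ E'] : E' →L[ℝ] ℝ :=
  LinearMap.toContinuousLinearMap (𝕜 := ℝ) (E := E')
    { toFun := fun V => CentralExt.coeff F (Φ.symm V)
      map_add' := fun V W => by
        exact (congrArg (CentralExt.coeff F) (map_add Φ.symm _ _)).trans (map_add _ _ _)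
      map_smul' := fun r V => by
        exact (congrArg (CentralExt.coeff F) (map_smul Φ.symm _ _)).trans (map_smul _ _ _) }

theorem liftCoeff_apply [FiniteDimensional ℝ E'] (V : E') : liftCoeff F Φ V = CentralExt.coeff F (Φ.symm V) := rfl

theorem liftCoeff_lift [FiniteDimensional ℝ E'] (X : E) (s : ℝ) : liftCoeff F Φ (lift F Φ X s) = s := by
  rw [liftCoeff_apply]
  exact (congrArg (CentralExt.coeff F) (Φ.symm_apply_apply _)).trans (CentralExt.coeff_mk F X s)

variable {F ρ Φ} (h : IsCentralExtension F ρ Φ)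

include h

theorem IsCentralExtension.mdifferentiableAt (k : G') :
    MDifferentiableAt 𝓘(ℝ, E') 𝓘(ℝ, E) ρ k := h.contMDiff.mdifferentiableAt (by simp)

theorem IsCentralExtension.mderiv_lift (X : E) (s : ℝ) :
    mderiv E' E ρ 1 (lift F Φ X s) = X := h.mfderiv_one X s

theorem IsCentralExtension.lift_mderiv [FiniteDimensional ℝ E'] (V : E') :
    V = lift F Φ (mderiv E' E ρ 1 V) (liftCoeff F Φ V) := by
  obtain ⟨X, s, rfl⟩ := exists_eq_lift F Φ V
  rw [h.mderiv_lift, liftCoeff_lift]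

theorem IsCentralExtension.mderiv_leftVec (V : E') (k : G') :
    mderiv E' E ρ k (leftVec V k) = leftVec (mderiv E' E ρ 1 V) (ρ k) := by
  have a1 := mderiv_comp_apply (g := ρ) (f := fun l : G' => k * l) (mul_one k)
    (h.mdifferentiableAt k) (mdifferentiableAt_mul_left k 1) V
  have a2 := mderiv_comp_apply (E' := E) (g := fun l : G => ρ k * l) (f := ρ) (map_one ρ)
    (mdifferentiableAt_mul_left (ρ k) 1) (h.mdifferentiableAt 1) V
  rw [leftVec, leftVec, ← a1, ← a2]
  simp only [map_mul]

theorem IsCentralExtension.mderiv_adL (V : E') (k : G') :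
    mderiv E' E ρ 1 (adL k V) = adL (ρ k) (mderiv E' E ρ 1 V) := by
  have a1 := mderiv_comp_apply (g := ρ) (f := fun l : G' => k * l * k⁻¹) (x := 1) (y := 1)
    (by simp) (h.mdifferentiableAt 1) (mdifferentiableAt_conj k 1) V
  have a2 := mderiv_comp_apply (E' := E) (g := fun l : G => ρ k * l * (ρ k)⁻¹) (f := ρ)
    (map_one ρ) (mdifferentiableAt_conj (ρ k) 1) (h.mdifferentiableAt 1) V
  rw [adL, adL, ← a1, ← a2]
  simp only [map_mul, map_inv]

omit h in
/-- The adjoint action fixes the central direction. -/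
theorem adL_lift_center [ConnectedSpace G'] (k : G') :
    adL k (lift F Φ (0 : E) 1) = lift F Φ (0 : E) 1 := by
  have hd : ∀ l : G', mderiv E' E' (fun k : G' => adL k (lift F Φ (0 : E) 1)) l = 0 := by
    intro l
    ext v
    obtain ⟨V, rfl⟩ := leftVec_surjective l v
    obtain ⟨X, s, rfl⟩ := exists_eq_lift F Φ V
    -- The derivative along the left field of `X + sZ` is `Ad_l [X + sZ, Z]`, which vanishes because
    -- `Z` is central.
    rw [MagneticFlow.mderiv_adL, lieBr_lift]
    have h1 : lieBr G X 0 = 0 := lie_zero (L := LieAlg E G) (M := LieAlg E G) X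
    have h2 : F.bil X 0 = 0 := (F.form X).map_zero
    have h3 : lift F Φ (0 : E) 0 = 0 := map_zero Φ
    rw [h1, h2, h3, map_zero, zero_apply]
  have := eq_of_mderiv_eq_zero (fun l => mdifferentiableAt_adL_apply (lift F Φ (0 : E) 1) l) hd k 1
  simpa only [adL_one] using this

/-- Two points over the same `g` differ by a central element, and conjugation by it is trivial. This
makes `f` independent of the section chosen in its definition. -/
theorem IsCentralExtension.adL_eq_of_map_eq {k l : G'} (hkl : ρ k = ρ l) :
    (adL k : E' →L[ℝ] E') = adL l := by
  have hz : k⁻¹ * l ∈ Subgroup.center G' := h.ker_le_center (by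
    rw [MonoidHom.mem_ker, map_mul, map_inv, hkl, inv_mul_cancel])
  have hk : l = k * (k⁻¹ * l) := by group
  have h1 : (adL (k⁻¹ * l) : E' →L[ℝ] E') = ContinuousLinearMap.id ℝ E' := by
    rw [adL]
    have : (fun m : G' => k⁻¹ * l * m * (k⁻¹ * l)⁻¹) = fun m => m := by
      funext m
      rw [← Subgroup.mem_center_iff.1 hz m, mul_inv_cancel_right]
    rw [this, mderiv_id]
  ext V
  rw [hk, adL_mul, h1, ContinuousLinearMap.id_apply]

variable [FiniteDimensional ℝ E']

/-- The cochain `f` on points of the extension. -/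
theorem IsCentralExtension.potentialCochain_map (Y : E) (k : G') :
    potentialCochain F ρ Φ h (Y : LieAlg E G) (ρ k) = -liftCoeff F Φ (adL k (lift F Φ Y 0)) := by
  rw [h.adL_eq_of_map_eq (Function.surjInv_eq h.surjective (ρ k)).symm]
  rfl

theorem IsCentralExtension.adL_lift (Y : E) (k : G') :
    adL k (lift F Φ Y 0) =
      lift F Φ (adL (ρ k) Y) (-potentialCochain F ρ Φ h (Y : LieAlg E G) (ρ k)) := by
  rw [h.potentialCochain_map, neg_neg]
  nth_rewrite 1 [h.lift_mderiv (adL k (lift F Φ Y 0))]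
  rw [h.mderiv_adL, h.mderiv_lift]

/-- The section `surjInv` in the definition of `f` need not be continuous. The pullback of `f` to
`G'` is visibly smooth, however, and `ρ` is a submersion, so smoothness descends along smooth local
sections. -/
theorem IsCentralExtension.contMDiff_potentialCochain [FiniteDimensional ℝ E] (Y : E) :
    ContMDiff 𝓘(ℝ, E) 𝓘(ℝ, ℝ) ∞ (potentialCochain F ρ Φ h (Y : LieAlg E G)) := by
  intro g
  obtain ⟨k, rfl⟩ := h.surjective g
  have hsurj : Function.Surjective (mderiv E' E ρ k) := by
    intro w
    obtain ⟨X, rfl⟩ := leftVec_surjective (ρ k) w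
    exact ⟨leftVec (lift F Φ X 0) k, by rw [h.mderiv_leftVec, h.mderiv_lift]⟩
  obtain ⟨A, hA⟩ := (mderiv E' E ρ k).toLinearMap.exists_rightInverse_of_surjective
    (LinearMap.range_eq_top.2 hsurj)
  obtain ⟨s, hs, hs0, hsr⟩ := exists_local_section h.contMDiff.contMDiffAt
    (LinearMap.toContinuousLinearMap A) (fun w => LinearMap.congr_fun hA w)
  have hS : ContMDiff 𝓘(ℝ, E') 𝓘(ℝ, ℝ) ∞
      (fun k : G' => -liftCoeff F Φ (adL k (lift F Φ Y 0))) :=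
    ((liftCoeff F Φ).contDiff.contMDiff.comp (contMDiff_adL.clm_apply contMDiff_const)).neg
  refine (hS.contMDiffAt.comp (ρ k) hs).congr_of_eventuallyEq ?_
  filter_upwards [hsr] with g hg
  rw [Function.comp_apply, ← h.potentialCochain_map, hg]

/-- `ξ_X f(Y) = f([X, Y]) - F(X, Y)`. -/
theorem IsCentralExtension.mderiv_potentialCochain [FiniteDimensional ℝ E] [ConnectedSpace G'] (X Y : E) (g : G) :
    mderiv E ℝ (potentialCochain F ρ Φ h (Y : LieAlg E G)) g (leftVec X g) =
      potentialCochain F ρ Φ h (lieBr G X Y : E) g - F.bil X Y := by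
  obtain ⟨k, rfl⟩ := h.surjective g
  have a1 := mderiv_comp_apply (g := potentialCochain F ρ Φ h (Y : LieAlg E G)) (f := ρ)
    (x := k) rfl ((h.contMDiff_potentialCochain Y).mdifferentiableAt (by simp))
    (h.mdifferentiableAt k) (leftVec (lift F Φ X 0) k)
  rw [h.mderiv_leftVec, h.mderiv_lift] at a1
  have e : (fun k => potentialCochain F ρ Φ h (Y : LieAlg E G) (ρ k)) =
      fun k => (-liftCoeff F Φ) (adL k (lift F Φ Y 0)) :=
    funext fun k => h.potentialCochain_map Y k
  rw [← a1, e, mderiv_comp_apply (E' := E') (g := (-liftCoeff F Φ))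
    (f := fun k : G' => adL k (lift F Φ Y 0)) rfl
    (-liftCoeff F Φ).differentiableAt.mdifferentiableAt
    (mdifferentiableAt_adL_apply _ k), mderiv_eq_fderiv, ContinuousLinearMap.fderiv,
    MagneticFlow.mderiv_adL, lieBr_lift, lift_eq_add, map_add, map_smul, adL_lift_center,
    h.potentialCochain_map]
  simp [liftCoeff_lift]
  ring

/-- `f([X, Y])(g) = F(X, Y) - F(Ad_g X, Ad_g Y)`. -/
theorem IsCentralExtension.potentialCochain_lieBr [ConnectedSpace G'] (X Y : E) (g : G) :
    potentialCochain F ρ Φ h (lieBr G X Y : E) g =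
      F.bil X Y - F.bil (adL g X) (adL g Y) := by
  obtain ⟨k, rfl⟩ := h.surjective g
  have h1 := adL_lieBr k (lift F Φ X 0) (lift F Φ Y 0)
  rw [lieBr_lift, lift_eq_add, map_add, map_smul, adL_lift_center, h.adL_lift, h.adL_lift,
    h.adL_lift, lieBr_lift] at h1
  have h2 := congrArg (liftCoeff F Φ) h1
  simp only [map_add, map_smul, liftCoeff_lift, smul_eq_mul, mul_one] at h2
  linarith

/-- `ξ̃_Y + η̃_{Ad_g Y} = -f(Y) ξ̃_Z`. -/
theorem IsCentralExtension.leftVec_sub_rightVec [ConnectedSpace G'] (Y : E) (k : G') :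
    leftVec (lift F Φ Y 0) k + -rightVec (lift F Φ (adL (ρ k) Y) 0) k =
      -(potentialCochain F ρ Φ h (Y : LieAlg E G) (ρ k)) • leftVec (lift F Φ (0 : E) 1) k := by
  have hadd (V W : E') : rightVec (V + W) k = rightVec V k + rightVec W k := map_add _ _ _
  have hsmul (r : ℝ) (V : E') : rightVec (r • V) k = r • rightVec V k := map_smul _ _ _
  rw [leftVec_eq_rightVec, h.adL_lift, lift_eq_add, hadd, hsmul, leftVec_eq_rightVec k (lift F Φ 0 1),
    adL_lift_center]
  abel

end CentralExtensions

/-! ### The canonical chart of the cotangent bundle and functions affine in the momenta. -/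

section Cotangent

variable {E : Type*} [NormedAddCommGroup E] [NormedSpace ℝ E]
  {M : Type*} [TopologicalSpace M] [ChartedSpace E M]

/-- A covector as a functional on the model space. -/
def covector (x : Cotangent E M) : E →L[ℝ] ℝ := x.2

/-- The function `p(V(g)) + c(g)` on the cotangent bundle. -/
def affineFunction (V : M → E) (c : M → ℝ) (x : Cotangent E M) : ℝ :=
  covector x (V x.1) + c x.1

variable [IsManifold 𝓘(ℝ, E) ∞ M]

/-- The differential of a function on the cotangent bundle, in the canonical chart. -/
def cotangentDeriv (φ : Cotangent E M → ℝ) (x : Cotangent E M) : (E × (E →L[ℝ] ℝ)) →L[ℝ] ℝ :=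
  mfderiv (cotangentModel E) 𝓘(ℝ, ℝ) φ x

/-- The fibre coordinate of the canonical chart of the cotangent bundle at a point over `g`. -/
def momentum (g : M) (z : Cotangent E M) : E →L[ℝ] ℝ :=
  (trivializationAt (E →L[ℝ] ℝ) (fun g : M => TangentSpace 𝓘(ℝ, E) g →L[ℝ] ℝ) g z).2

theorem momentum_apply (g : M) (z : Cotangent E M) (v : E) :
    momentum g z v =
      covector z ((trivializationAt E (TangentSpace 𝓘(ℝ, E)) g).symmL ℝ z.1 v) := by
  have h := Trivialization.continuousLinearMapAt_apply_of_mem (R := ℝ)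
    (trivializationAt ℝ (fun _ : M => ℝ) g) (b := z.1) (Set.mem_univ _)
    (covector z ((trivializationAt E (TangentSpace 𝓘(ℝ, E)) g).symmL ℝ z.1 v))
  exact h

theorem extChartAt_cotangent (x z : Cotangent E M) :
    extChartAt (cotangentModel E) x z = (extChartAt 𝓘(ℝ, E) x.1 z.1, momentum x.1 z) := by
  rw [FiberBundle.extChartAt]
  rfl

/-- The trivialization of covectors is dual to that of vectors, so the pairing can be computed in
coordinates. This makes `affineFunction` explicit in the canonical chart. -/
theorem momentum_chartDerivative {g : M} {z : Cotangent E M} (hz : z.1 ∈ (chartAt E g).source)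
    (V : M → E) : momentum g z (chartDerivative g V z.1) = covector z (V z.1) := by
  rw [momentum_apply, chartDerivative, ← continuousLinearMapAt_trivializationAt_eq_mderiv hz]
  exact congrArg (covector z)
    ((trivializationAt E (TangentSpace 𝓘(ℝ, E)) g).symmL_continuousLinearMapAt (R := ℝ) hz (V z.1))

theorem momentum_self (x : Cotangent E M) : momentum x.1 x = covector x := by
  ext v
  have h := momentum_chartDerivative (z := x) (mem_chart_source E x.1) (fun _ => v)
  rwa [chartDerivative_self] at h

theorem contMDiffAt_momentum (g : M) {x : Cotangent E M} (hx : x.1 = g) :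
    ContMDiffAt (cotangentModel E) 𝓘(ℝ, E →L[ℝ] ℝ) ∞ (momentum g : Cotangent E M → _) x := by
  subst hx
  exact ((contMDiffAt_totalSpace (F := E →L[ℝ] ℝ)
    (E := fun g : M => TangentSpace 𝓘(ℝ, E) g →L[ℝ] ℝ) (IB := 𝓘(ℝ, E)) (f := fun z => z)
    (x₀ := x)).1 contMDiffAt_id).2

theorem eventually_mem_chart_source (x : Cotangent E M) :
    ∀ᶠ z in 𝓝 x, z.1 ∈ (chartAt E x.1).source :=
  (FiberBundle.continuous_proj (E →L[ℝ] ℝ)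
    (fun g : M => TangentSpace 𝓘(ℝ, E) g →L[ℝ] ℝ)).continuousAt.preimage_mem_nhds
    ((chartAt E x.1).open_source.mem_nhds (mem_chart_source E x.1))

theorem affineFunction_eventuallyEq (V : M → E) (c : M → ℝ) (x : Cotangent E M) :
    affineFunction V c =ᶠ[𝓝 x]
      fun z => momentum x.1 z (chartDerivative x.1 V z.1) + c z.1 := by
  filter_upwards [eventually_mem_chart_source x] with z hz
  rw [momentum_chartDerivative hz, affineFunction]

theorem contMDiffAt_chartDerivative {g : M} {V : M → E}
    (hV : ContMDiffAt 𝓘(ℝ, E) (𝓘(ℝ, E).prod 𝓘(ℝ, E)) ∞ (tangentSection V) g) :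
    ContMDiffAt 𝓘(ℝ, E) 𝓘(ℝ, E) ∞ (chartDerivative g V) g := by
  refine ((contMDiffAt_section (E := TangentSpace 𝓘(ℝ, E)) (IB := 𝓘(ℝ, E)) g).1
    hV).congr_of_eventuallyEq ?_
  filter_upwards [(chartAt E g).open_source.mem_nhds (mem_chart_source E g)] with x hx
  exact chartDerivative_eq_trivializationAt V hx

theorem contMDiff_affineFunction {V : M → E} {c : M → ℝ}
    (hV : ContMDiff 𝓘(ℝ, E) (𝓘(ℝ, E).prod 𝓘(ℝ, E)) ∞ (tangentSection V))
    (hc : ContMDiff 𝓘(ℝ, E) 𝓘(ℝ, ℝ) ∞ c) :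
    ContMDiff (cotangentModel E) 𝓘(ℝ, ℝ) ∞ (affineFunction V c) := by
  intro x
  have hp : ContMDiff (cotangentModel E) 𝓘(ℝ, E) ∞ (fun z : Cotangent E M => z.1) :=
    Bundle.contMDiff_proj (fun g : M => TangentSpace 𝓘(ℝ, E) g →L[ℝ] ℝ)
  have hV' : ContMDiffAt (cotangentModel E) 𝓘(ℝ, E) ∞
      (fun z : Cotangent E M => chartDerivative x.1 V z.1) x :=
    ContMDiffAt.comp x (contMDiffAt_chartDerivative (hV x.1)) (hp x)
  exact (((contMDiffAt_momentum x.1 rfl).clm_apply hV').add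
    ((hc.comp hp) x)).congr_of_eventuallyEq (affineFunction_eventuallyEq V c x)

theorem hasFDerivAt_cotangent {φ : Cotangent E M → ℝ} {x : Cotangent E M}
    (hφ : MDifferentiableAt (cotangentModel E) 𝓘(ℝ, ℝ) φ x) :
    HasFDerivAt (φ ∘ (extChartAt (cotangentModel E) x).symm) (cotangentDeriv φ x)
      (extChartAt (cotangentModel E) x x) := by
  have h := hφ.hasMFDerivAt.2
  rw [ModelWithCorners.range_eq_univ] at h
  exact hasFDerivWithinAt_univ.1 h

/-- In the canonical chart the function is `q.2 (V q.1) + c q.1`, with `V` and `c` in coordinates,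
so its differential comes from the product rule. -/
theorem cotangentDeriv_affineFunction {V : M → E} {c : M → ℝ}
    (hV : ContMDiff 𝓘(ℝ, E) (𝓘(ℝ, E).prod 𝓘(ℝ, E)) ∞ (tangentSection V))
    (hc : ContMDiff 𝓘(ℝ, E) 𝓘(ℝ, ℝ) ∞ c) (x : Cotangent E M) (w : E) (β : E →L[ℝ] ℝ) :
    cotangentDeriv (affineFunction V c) x (w, β) =
      β (V x.1) + covector x (mderiv E E (chartDerivative x.1 V) x.1 w) + mderiv E ℝ c x.1 w := by
  have h0 := hasFDerivAt_cotangent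
    ((contMDiff_affineFunction hV hc).mdifferentiableAt (x := x) (by simp))
  have hx : extChartAt (cotangentModel E) x x = (extChartAt 𝓘(ℝ, E) x.1 x.1, covector x) := by
    rw [extChartAt_cotangent, momentum_self]
  have hV' := hasFDerivAt_comp_chart_symm
    (mdifferentiableAt_chartDerivative (hV.mdifferentiableAt (x := x.1) (by simp)))
  have hc' := hasFDerivAt_comp_chart_symm (hc.mdifferentiableAt (x := x.1) (by simp))
  have h1 := (hasFDerivAt_snd (𝕜 := ℝ) (p := (extChartAt 𝓘(ℝ, E) x.1 x.1, covector x))).clm_apply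
    (hV'.comp (f := Prod.fst) (extChartAt 𝓘(ℝ, E) x.1 x.1, covector x) hasFDerivAt_fst) |>.add
      (hc'.comp (f := Prod.fst) (extChartAt 𝓘(ℝ, E) x.1 x.1, covector x) hasFDerivAt_fst)
  have he : (affineFunction V c ∘ (extChartAt (cotangentModel E) x).symm)
      =ᶠ[𝓝 (extChartAt (cotangentModel E) x x)] (fun q : E × (E →L[ℝ] ℝ) =>
      q.2 ((chartDerivative x.1 V ∘ (extChartAt 𝓘(ℝ, E) x.1).symm) q.1) +
        (c ∘ (extChartAt 𝓘(ℝ, E) x.1).symm) q.1) := by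
    have ht' : Tendsto (extChartAt (cotangentModel E) x).symm
        (𝓝 (extChartAt (cotangentModel E) x x)) (𝓝 x) := by
      have ht := continuousAt_extChartAt_symm (I := cotangentModel E) x
      rwa [ContinuousAt, extChartAt_to_inv] at ht
    filter_upwards [ht'.eventually (affineFunction_eventuallyEq V c x),
      ht'.eventually (eventually_mem_chart_source x),
      extChartAt_target_mem_nhds (I := cotangentModel E) x] with q hq hs hq'
    have hr := (extChartAt (cotangentModel E) x).right_inv hq'
    rw [extChartAt_cotangent] at hr
    have hz : (extChartAt 𝓘(ℝ, E) x.1).symm q.1 = ((extChartAt (cotangentModel E) x).symm q).1 := by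
      have := (extChartAt 𝓘(ℝ, E) x.1).left_inv ((extChartAt_source 𝓘(ℝ, E) x.1).symm ▸ hs)
      rwa [show extChartAt 𝓘(ℝ, E) x.1 _ = q.1 from congrArg Prod.fst hr] at this
    rw [Function.comp_apply, hq, Function.comp_apply, Function.comp_apply, hz,
      show momentum x.1 _ = q.2 from congrArg Prod.snd hr]
  rw [hx] at h0 he
  rw [h0.unique (h1.congr_of_eventuallyEq he)]
  simp [chartDerivative_self, add_comm]

end Cotangent

/-! ### The magnetic Poisson bracket. -/

section Poisson

variable {E : Type*} [NormedAddCommGroup E] [NormedSpace ℝ E] [CompleteSpace E]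
  {G : Type*} [TopologicalSpace G] [ChartedSpace E G] [Group G] [LieGroup 𝓘(ℝ, E) ∞ G]
  (e : ℝ) (F : Cocycle E G)

/-- The magnetic form on the model space. -/
def magForm (g : G) (v w : E) : ℝ := magneticForm F g v w

theorem magForm_rightVec (g : G) (V W : E) :
    magForm F g (rightVec V g) (rightVec W g) = F.bil V W := by
  have h (V : E) : mderiv E E (fun h : G => h * g⁻¹) g (rightVec V g) = V := by
    have := mderiv_comp_apply (E := E) (E' := E) (E'' := E) (g := fun h : G => h * g⁻¹)
      (f := fun h : G => h * g) (x := 1) (one_mul g) (mdifferentiableAt_mul_right g⁻¹ g)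
      (mdifferentiableAt_mul_right g 1) V
    rw [rightVec, ← this]
    simp only [mul_inv_cancel_right, mderiv_id, ContinuousLinearMap.id_apply]
  have h' : magForm F g (rightVec V g) (rightVec W g) =
    F.bil (mderiv E E (fun h : G => h * g⁻¹) g (rightVec V g))
      (mderiv E E (fun h : G => h * g⁻¹) g (rightVec W g)) := rfl
  rw [h', h, h]

/-- The form is right-invariant, so left-invariant fields must first be written as right translates;
this is where `Ad_g` enters. -/
theorem magForm_leftVec (g : G) (X Y : E) :
    magForm F g (leftVec X g) (leftVec Y g) = F.bil (adL g X) (adL g Y) := by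
  rw [leftVec_eq_rightVec, leftVec_eq_rightVec, magForm_rightVec]

theorem magForm_swap (g : G) (v w : E) : magForm F g v w = -magForm F g w v :=
  F.bil_swap (mderiv E E (fun h : G => h * g⁻¹) g v) (mderiv E E (fun h : G => h * g⁻¹) g w)

variable [FiniteDimensional ℝ E]

/-- The Hamiltonian vector field in the canonical chart. -/
def hamVec (φ : Cotangent E G → ℝ) (x : Cotangent E G) : E × (E →L[ℝ] ℝ) :=
  hamiltonianField e F φ x

theorem hamVec_spec (φ : Cotangent E G → ℝ) (x : Cotangent E G) (ζ : E × (E →L[ℝ] ℝ)) :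
    ζ.2 (hamVec e F φ x).1 - (hamVec e F φ x).2 ζ.1 + e * magForm F x.1 (hamVec e F φ x).1 ζ.1 =
      cotangentDeriv φ x ζ :=
  (existsUnique_hamiltonianVector e F φ x).choose_spec.1 ζ

theorem cotangentDeriv_hamVec_swap (φ ψ : Cotangent E G → ℝ) (x : Cotangent E G) :
    cotangentDeriv φ x (hamVec e F ψ x) = -cotangentDeriv ψ x (hamVec e F φ x) := by
  rw [← hamVec_spec e F φ, ← hamVec_spec e F ψ, magForm_swap]
  ring

theorem poissonBracket_eq (φ ψ : Cotangent E G → ℝ) (x : Cotangent E G) :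
    poissonBracket e F φ ψ x = cotangentDeriv ψ x (hamVec e F φ x) := by
  rw [cotangentDeriv_hamVec_swap, ← hamVec_spec e F φ]
  rfl

/-- The Poisson bracket of two functions that are affine in the momenta. -/
theorem poissonBracket_affineFunction {V W : G → E} {c d : G → ℝ}
    (hV : ContMDiff 𝓘(ℝ, E) (𝓘(ℝ, E).prod 𝓘(ℝ, E)) ∞ (tangentSection V))
    (hW : ContMDiff 𝓘(ℝ, E) (𝓘(ℝ, E).prod 𝓘(ℝ, E)) ∞ (tangentSection W))
    (hc : ContMDiff 𝓘(ℝ, E) 𝓘(ℝ, ℝ) ∞ c) (hd : ContMDiff 𝓘(ℝ, E) 𝓘(ℝ, ℝ) ∞ d)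
    (x : Cotangent E G) :
    poissonBracket e F (affineFunction V c) (affineFunction W d) x =
      covector x (vectorBracket V W x.1) + mderiv E ℝ d x.1 (V x.1) - mderiv E ℝ c x.1 (W x.1) +
        e * magForm F x.1 (V x.1) (W x.1) := by
  have hs := hamVec_spec e F (affineFunction V c) x
  rw [poissonBracket_eq]
  generalize hamVec e F (affineFunction V c) x = ζ at hs ⊢
  obtain ⟨a, b⟩ := ζ
  have h0 (v : E) : magForm F x.1 v 0 = 0 := by
    have h := magneticForm_smul_right F x.1 0 v 0
    rwa [zero_smul, zero_mul] at h
  -- Vertical test vectors `(0, β)` determine the base component of the Hamiltonian vector. Of its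
  -- fibre component only the value at `W` is needed, and the test vector `(W, 0)` supplies it.
  have ha : a = V x.1 := by
    refine sub_eq_zero.1 (SeparatingDual.eq_zero_of_forall_dual_eq_zero (R := ℝ) fun β => ?_)
    have h1 := hs (0, β)
    rw [cotangentDeriv_affineFunction hV hc, h0] at h1
    simp only [map_zero] at h1
    rw [map_sub]
    linarith
  have hb := hs (W x.1, 0)
  rw [cotangentDeriv_affineFunction hV hc] at hb
  rw [cotangentDeriv_affineFunction hW hd,
    mlieBracket_eq_mderiv_chartDerivative
      (mdifferentiableAt_chartDerivative (hV.mdifferentiableAt (by simp)))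
      (mdifferentiableAt_chartDerivative (hW.mdifferentiableAt (by simp))), map_sub]
  subst ha
  simp only [zero_apply] at hb
  linarith

end Poisson

/-! ### Linearity and the Leibniz rule for differentials on the cotangent bundle. -/

section MetricHamiltonian

variable {E : Type*} [NormedAddCommGroup E] [NormedSpace ℝ E]
  {M : Type*} [TopologicalSpace M] [ChartedSpace E M] [IsManifold 𝓘(ℝ, E) ∞ M]

theorem cotangentDeriv_const (r : ℝ) (x : Cotangent E M) (ζ : E × (E →L[ℝ] ℝ)) :
    cotangentDeriv (fun _ => r) x ζ = 0 := by
  rw [cotangentDeriv, mfderiv_const]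
  rfl

theorem cotangentDeriv_add {φ ψ : Cotangent E M → ℝ} {x : Cotangent E M}
    (hφ : MDifferentiableAt (cotangentModel E) 𝓘(ℝ, ℝ) φ x)
    (hψ : MDifferentiableAt (cotangentModel E) 𝓘(ℝ, ℝ) ψ x) (ζ : E × (E →L[ℝ] ℝ)) :
    cotangentDeriv (φ + ψ) x ζ = cotangentDeriv φ x ζ + cotangentDeriv ψ x ζ := by
  rw [(hasFDerivAt_cotangent (hφ.add hψ)).unique
    ((hasFDerivAt_cotangent hφ).add (hasFDerivAt_cotangent hψ))]
  rfl

theorem cotangentDeriv_smul {φ : Cotangent E M → ℝ} {x : Cotangent E M}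
    (hφ : MDifferentiableAt (cotangentModel E) 𝓘(ℝ, ℝ) φ x) (r : ℝ) (ζ : E × (E →L[ℝ] ℝ)) :
    cotangentDeriv (r • φ) x ζ = r * cotangentDeriv φ x ζ := by
  rw [(hasFDerivAt_cotangent (hφ.const_smul r)).unique
    ((hasFDerivAt_cotangent hφ).const_smul r)]
  rfl

/-- A tangent vector that annihilates the differentials of some functions annihilates the
differential of every sum of products of these functions. -/
theorem cotangentDeriv_sum_mul_eq_zero {ι : Type*} {s : Finset ι} {P Q : ι → Cotangent E M → ℝ}
    (hP : ∀ i, ContMDiff (cotangentModel E) 𝓘(ℝ, ℝ) ∞ (P i))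
    (hQ : ∀ i, ContMDiff (cotangentModel E) 𝓘(ℝ, ℝ) ∞ (Q i)) {x : Cotangent E M}
    {ζ : E × (E →L[ℝ] ℝ)} (hP0 : ∀ i, cotangentDeriv (P i) x ζ = 0)
    (hQ0 : ∀ i, cotangentDeriv (Q i) x ζ = 0) (r : ℝ) :
    cotangentDeriv (fun z => r * ∑ i ∈ s, P i z * Q i z) x ζ = 0 := by
  have hd : MDifferentiableAt (cotangentModel E) 𝓘(ℝ, ℝ) (fun z => r * ∑ i ∈ s, P i z * Q i z) x :=
    (contMDiff_const.mul (contMDiff_finsetSum fun i _ => (hP i).mul (hQ i))).mdifferentiableAt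
      (by simp)
  have h := (HasFDerivAt.fun_sum (u := s) fun i _ =>
    (hasFDerivAt_cotangent ((hP i).mdifferentiableAt (x := x) (by simp))).mul
      (hasFDerivAt_cotangent ((hQ i).mdifferentiableAt (x := x) (by simp)))).const_mul r
  rw [(hasFDerivAt_cotangent hd).unique h]
  simp [hP0, hQ0]

end MetricHamiltonian

/-! ### The Hamiltonian as a quadratic form in right-invariant momenta. -/

section RightInvariant

variable {E : Type*} [NormedAddCommGroup E] [NormedSpace ℝ E] [FiniteDimensional ℝ E]
  {G : Type*} [TopologicalSpace G] [ChartedSpace E G] [Group G]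

/-- The energy of a right-invariant metric is a quadratic expression in right-invariant momenta. -/
theorem exists_metricHamiltonian_eq (B : LinearMap.BilinForm ℝ (LieAlg E G))
    (hB : B.Nondegenerate) : ∃ (n : ℕ) (V W : Fin n → E),
      metricHamiltonian B hB = fun x : Cotangent E G =>
        (1 / 2) * ∑ i, affineFunction (rightVec (V i)) 0 x * affineFunction (rightVec (W i)) 0 x := by
  have : FiniteDimensional ℝ (LieAlg E G) := inferInstanceAs (FiniteDimensional ℝ E)
  let b := Module.finBasis ℝ (LieAlg E G)
  -- Expanding `q` in the dual basis pairs each basis vector with the image of its coordinate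
  -- functional under the inverse of `B`.
  refine ⟨_, fun i => b i, fun i => (B.toDual hB).symm (b.coord i), ?_⟩
  funext x
  let q : Module.Dual ℝ (LieAlg E G) := (x.2.comp (rightTranslateFromOne x.1)).toLinearMap
  have hq : q = ∑ i, q (b i) • b.coord i := (b.sum_dual_apply_smul_coord q).symm
  have h1 : metricHamiltonian B hB x = (1 / 2) * q ((B.toDual hB).symm q) := rfl
  have h2 : (B.toDual hB).symm q = ∑ i, q (b i) • (B.toDual hB).symm (b.coord i) := by
    conv_lhs => rw [hq]
    rw [map_sum]
    simp only [map_smul]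
  have h3 : q ((B.toDual hB).symm q) =
      ∑ i, q (b i) * q ((B.toDual hB).symm (b.coord i)) := by
    conv_lhs => rw [h2]
    rw [map_sum]
    simp only [map_smul, smul_eq_mul]
  have h4 (W : LieAlg E G) : q W = affineFunction (rightVec (E := E) W) 0 x := (add_zero _).symm
  rw [h1, h3]
  simp only [h4]

end RightInvariant

/-! ### Commutation relations and conservation of the deformed functions. -/

section Integrals

variable {E : Type*} [NormedAddCommGroup E] [NormedSpace ℝ E] [CompleteSpace E]
  {G : Type*} [TopologicalSpace G] [ChartedSpace E G] [Group G] [LieGroup 𝓘(ℝ, E) ∞ G]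
  {e : ℝ} {F : Cocycle E G}

variable {E' : Type*} [NormedAddCommGroup E'] [NormedSpace ℝ E'] [CompleteSpace E']
  {G' : Type*} [TopologicalSpace G'] [ChartedSpace E' G'] [Group G'] [LieGroup 𝓘(ℝ, E') ∞ G']
  {ρ : G' →* G} {Φ : CentralExt F ≃ₗ⁅ℝ⁆ LieAlg E' G'}
  (h : IsCentralExtension F ρ Φ)

/-- The value of the 1-cochain on the model space. -/
def IsCentralExtension.cochain (X : E) : G → ℝ := potentialCochain F ρ Φ h (X : LieAlg E G)

/-- The function `ξ^(e)_X - s`, with `X` in the model space. -/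
def IsCentralExtension.integral (e : ℝ) (X : E) (s : ℝ) : Cotangent E G → ℝ :=
  affineFunction (leftVec X) (fun g => e * h.cochain X g - s)

theorem IsCentralExtension.deformedFunction_sub_eq (e : ℝ) (X : LieAlg E G) (s : ℝ) :
    (fun x => deformedFunction e (potentialCochain F ρ Φ h) X x - s) = h.integral e X s :=
  funext fun _ => add_sub_assoc _ _ _

theorem IsCentralExtension.deformedFunction_eq (e : ℝ) (X : LieAlg E G) :
    deformedFunction e (potentialCochain F ρ Φ h) X = h.integral e X 0 := by
  rw [← h.deformedFunction_sub_eq]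
  simp only [sub_zero]

theorem IsCentralExtension.cochain_lieBr_swap (X Y : E) (g : G) :
    h.cochain (lieBr G Y X) g = -h.cochain (lieBr G X Y) g := by
  have h1 : lieBr G Y X = -lieBr G X Y := (lie_skew (L := LieAlg E G) Y X).symm
  rw [h1]
  exact congrFun (map_neg (potentialCochain F ρ Φ h) _) g

variable [FiniteDimensional ℝ E']

theorem IsCentralExtension.cochain_lieBr [ConnectedSpace G'] (X Y : E) (g : G) :
    h.cochain (lieBr G X Y) g = F.bil X Y - F.bil (adL g X) (adL g Y) :=
  h.potentialCochain_lieBr X Y g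

variable [FiniteDimensional ℝ E]

theorem IsCentralExtension.contMDiff_shift (X : E) (s : ℝ) :
    ContMDiff 𝓘(ℝ, E) 𝓘(ℝ, ℝ) ∞ (fun g => e * h.cochain X g - s) :=
  (contMDiff_const.mul (h.contMDiff_potentialCochain X)).sub contMDiff_const

theorem IsCentralExtension.mderiv_shift [ConnectedSpace G'] (X Y : E) (s : ℝ) (g : G) :
    mderiv E ℝ (fun g => e * h.cochain Y g - s) g (leftVec X g) =
      e * (h.cochain (lieBr G X Y) g - F.bil X Y) := by
  have hd : MDifferentiableAt 𝓘(ℝ, E) 𝓘(ℝ, ℝ) (h.cochain Y) g :=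
    (h.contMDiff_potentialCochain Y).mdifferentiableAt (by simp)
  have h1 := mderiv_comp_apply (E'' := ℝ) (g := fun r : ℝ => e * r - s) rfl
    (((contDiff_const.mul contDiff_id).sub contDiff_const).contMDiff (n := 1)
      |>.mdifferentiableAt (by simp)) hd (leftVec X g)
  have h2 : HasDerivAt (fun r : ℝ => e * r - s) e (h.cochain Y g) := by
    simpa using ((hasDerivAt_id (h.cochain Y g)).const_mul e).sub_const s
  rw [h1, mderiv_eq_fderiv, h2.hasFDerivAt.fderiv]
  have h3 : mderiv E ℝ (h.cochain Y) g (leftVec X g) = _ := h.mderiv_potentialCochain X Y g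
  rw [h3]
  simp [IsCentralExtension.cochain, mul_comm]

theorem IsCentralExtension.contMDiff_integral (X : E) (s : ℝ) :
    ContMDiff (cotangentModel E) 𝓘(ℝ, ℝ) ∞ (h.integral e X s) :=
  contMDiff_affineFunction (contMDiff_leftVec X) (h.contMDiff_shift X s)

/-- A smooth function whose derivative along the Hamiltonian vector field vanishes is an integral
of motion. -/
theorem isIntegralOfMotion_of_cotangentDeriv {H φ : Cotangent E G → ℝ}
    (hφ : ContMDiff (cotangentModel E) 𝓘(ℝ, ℝ) ∞ φ)
    (h0 : ∀ x, cotangentDeriv φ x (hamVec e F H x) = 0) : IsIntegralOfMotion e F H φ := by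
  refine ⟨hφ, fun γ s hs hc hγ t ht u hu => ?_⟩
  have hd : ∀ t ∈ s, HasDerivAt (φ ∘ γ) 0 t := by
    intro t ht
    have h1 := (hγ t ht).hasMFDerivAt (hs.mem_nhds ht)
    -- The chain rule: the derivative of `φ ∘ γ` is `dφ` on the Hamiltonian vector.
    let L : ℝ →L[ℝ] ℝ := (cotangentDeriv φ (γ t)).comp
      (ContinuousLinearMap.smulRight (1 : ℝ →L[ℝ] ℝ) (hamVec e F H (γ t)))
    have h2 : HasFDerivAt (φ ∘ γ) L t := hasMFDerivAt_iff_hasFDerivAt.1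
      ((hφ.mdifferentiableAt (x := γ t) (by simp)).hasMFDerivAt.comp t h1)
    have h3 : L 1 = 0 := by
      rw [← h0 (γ t)]
      simp [L]
    exact h3 ▸ h2.hasDerivAt
  exact hs.is_const_of_deriv_eq_zero hc.isPreconnected
    (fun t ht => (hd t ht).differentiableAt.differentiableWithinAt) (fun t ht => (hd t ht).deriv)
    ht hu

/-- The commutation relations of the deformed left-invariant functions. -/
theorem IsCentralExtension.poissonBracket_integral [ConnectedSpace G'] (X Y : E) (s t : ℝ) :
    poissonBracket e F (h.integral e X s) (h.integral e Y t) =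
      h.integral e (lieBr G X Y) (e * F.bil X Y) := by
  funext x
  rw [IsCentralExtension.integral, IsCentralExtension.integral, IsCentralExtension.integral,
    poissonBracket_affineFunction e F (contMDiff_leftVec X) (contMDiff_leftVec Y)
      (h.contMDiff_shift X s) (h.contMDiff_shift Y t), vectorBracket_leftVec, h.mderiv_shift,
    h.mderiv_shift, magForm_leftVec, h.cochain_lieBr_swap X Y, affineFunction, F.bil_swap Y X,
    h.cochain_lieBr]
  ring

/-- At the given point the right field of `W` is the left field of `Ad_g⁻¹ W`. The two identities
for `f` give its derivative there as `-F(W, Ad_g X)`, which cancels the magnetic term `F(Ad_g X, W)`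
by antisymmetry. -/
theorem IsCentralExtension.poissonBracket_integral_rightVec [ConnectedSpace G'] (X W : E) (s : ℝ)
    (x : Cotangent E G) :
    poissonBracket e F (h.integral e X s) (affineFunction (rightVec W) 0) x = 0 := by
  have hd := h.mderiv_shift (e := e) (adL x.1⁻¹ W) X s x.1
  rw [← rightVec_eq_leftVec, h.cochain_lieBr, adL_adL_inv] at hd
  have h0 : mderiv E ℝ (0 : G → ℝ) x.1 = 0 := mderiv_const 0 x.1
  rw [IsCentralExtension.integral, poissonBracket_affineFunction e F (contMDiff_leftVec X)
    (contMDiff_rightVec W) (h.contMDiff_shift X s) (d := 0) contMDiff_const,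
    vectorBracket_leftVec_rightVec, hd, h0, leftVec_eq_rightVec, magForm_rightVec, F.bil_swap W, map_zero, zero_apply]
  ring

theorem IsCentralExtension.poissonBracket_integral_metricHamiltonian [ConnectedSpace G']
    (B : LinearMap.BilinForm ℝ (LieAlg E G)) (hB : B.Nondegenerate) (X : E) (s : ℝ) :
    poissonBracket e F (h.integral e X s) (metricHamiltonian B hB) = 0 := by
  obtain ⟨n, V, W, hH⟩ := exists_metricHamiltonian_eq B hB
  funext x
  have h0 (W : E) : cotangentDeriv (affineFunction (rightVec W) 0) x
      (hamVec e F (h.integral e X s) x) = 0 := by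
    rw [← poissonBracket_eq, h.poissonBracket_integral_rightVec]
  have hP (W : E) : ContMDiff (cotangentModel E) 𝓘(ℝ, ℝ) ∞
      (affineFunction (rightVec W) 0 : Cotangent E G → ℝ) :=
    contMDiff_affineFunction (contMDiff_rightVec W) contMDiff_const
  rw [poissonBracket_eq, hH]
  exact cotangentDeriv_sum_mul_eq_zero (fun i => hP (V i)) (fun i => hP (W i))
    (fun i => h0 (V i)) (fun i => h0 (W i)) _

/-- Smoothness and a vanishing derivative along the Hamiltonian field are linear conditions, so the
generators suffice. Antisymmetry of the symplectic form turns `{ξ, H} = 0` into `dξ(X_H) = 0`. -/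
theorem IsCentralExtension.cotangentDeriv_eq_zero_of_mem [ConnectedSpace G']
    (B : LinearMap.BilinForm ℝ (LieAlg E G)) (hB : B.Nondegenerate) {φ : Cotangent E G → ℝ}
    (hφ : φ ∈ integralAlgebra e (potentialCochain F ρ Φ h)) :
    ContMDiff (cotangentModel E) 𝓘(ℝ, ℝ) ∞ φ ∧
      ∀ x, cotangentDeriv φ x (hamVec e F (metricHamiltonian B hB) x) = 0 := by
  refine Submodule.span_induction ?_ ?_ ?_ ?_ hφ
  · rintro _ (⟨X, rfl⟩ | rfl)
    · rw [h.deformedFunction_eq]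
      refine ⟨h.contMDiff_integral X 0, fun x => ?_⟩
      rw [cotangentDeriv_hamVec_swap, ← poissonBracket_eq]
      exact neg_eq_zero.2 (congrFun (h.poissonBracket_integral_metricHamiltonian B hB X 0) x)
    · exact ⟨contMDiff_const, fun x => cotangentDeriv_const 1 x _⟩
  · exact ⟨contMDiff_const, fun x => cotangentDeriv_const 0 x _⟩
  · rintro φ ψ - - ⟨h1, h2⟩ ⟨h3, h4⟩
    refine ⟨h1.add h3, fun x => ?_⟩
    rw [cotangentDeriv_add (h1.mdifferentiableAt (by simp)) (h3.mdifferentiableAt (by simp)), h2,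
      h4, add_zero]
  · rintro r φ - ⟨h1, h2⟩
    refine ⟨(contMDiff_const (c := r)).mul h1, fun x => ?_⟩
    rw [cotangentDeriv_smul (h1.mdifferentiableAt (by simp)), h2, mul_zero]

theorem IsCentralExtension.isIntegralOfMotion [ConnectedSpace G']
    (B : LinearMap.BilinForm ℝ (LieAlg E G)) (hB : B.Nondegenerate) {φ : Cotangent E G → ℝ}
    (hφ : φ ∈ integralAlgebra e (potentialCochain F ρ Φ h)) :
    IsIntegralOfMotion e F (metricHamiltonian B hB) φ :=
  isIntegralOfMotion_of_cotangentDeriv (h.cotangentDeriv_eq_zero_of_mem B hB hφ).1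
    (h.cotangentDeriv_eq_zero_of_mem B hB hφ).2

end Integrals

/-! ### Linearity and independence of the deformed functions. -/

section Deformed

variable {E : Type*} [NormedAddCommGroup E] [NormedSpace ℝ E]
  {G : Type*} [TopologicalSpace G] [ChartedSpace E G] [Group G]
  (e : ℝ) (f : LieAlg E G →ₗ[ℝ] (G → ℝ))

theorem deformedFunction_add (X Y : LieAlg E G) :
    deformedFunction e f (X + Y) = deformedFunction e f X + deformedFunction e f Y := by
  funext x
  have h1 : leftFunction (X + Y) x = leftFunction X x + leftFunction Y x := by
    have h2 : leftVec (E := E) (X + Y) x.1 = leftVec (E := E) X x.1 + leftVec (E := E) Y x.1 :=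
      map_add (mderiv E E (fun h : G => x.1 * h) 1) _ _
    exact (congrArg (covector x) h2).trans (map_add (covector x) _ _)
  simp only [deformedFunction, Pi.add_apply, h1, map_add]
  ring

theorem deformedFunction_smul (r : ℝ) (X : LieAlg E G) :
    deformedFunction e f (r • X) = r • deformedFunction e f X := by
  funext x
  have h1 : leftFunction (r • X) x = r * leftFunction X x := by
    have h2 : leftVec (E := E) (r • X) x.1 = r • leftVec (E := E) X x.1 :=
      map_smul (mderiv E E (fun h : G => x.1 * h) 1) _ _
    exact (congrArg (covector x) h2).trans (map_smul (covector x) _ _)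
  simp only [deformedFunction, Pi.smul_apply, h1, map_smul, smul_eq_mul]
  ring

/-- On the fibre over the identity the function is `p X` plus a constant. Comparing `p` with `0`
gives `p X = 0` for every covector `p`. -/
theorem eq_zero_of_deformedFunction_eq_const {X : LieAlg E G} {r : ℝ}
    (h : ∀ x, deformedFunction e f X x = r) : X = 0 := by
  refine SeparatingDual.eq_zero_of_forall_dual_eq_zero (R := ℝ) (V := E) fun p => ?_
  have hp (p : E →L[ℝ] ℝ) : p X + e * f X 1 = r := by
    have h1 : leftVec (E := E) X (1 : G) = X := leftVec_one (E := E) X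
    exact (congrArg (fun v : E => p v + e * f X 1) h1).symm.trans (h ⟨1, p⟩)
  have h0 : 0 + e * f X 1 = r := hp 0
  linarith [hp p]

end Deformed

/-! ### The algebra of integrals as a copy of the central extension. -/

section Algebra

variable {E : Type*} [NormedAddCommGroup E] [NormedSpace ℝ E] [CompleteSpace E]
  {G : Type*} [TopologicalSpace G] [ChartedSpace E G] [Group G] [LieGroup 𝓘(ℝ, E) ∞ G]
  (F : Cocycle E G) (e : ℝ) (f : LieAlg E G →ₗ[ℝ] (G → ℝ))

/-- The projection `X + sZ ↦ X`. -/
def CentralExt.base : CentralExt F →ₗ[ℝ] LieAlg E G where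
  toFun a := ((LieAlgebra.ofProd F).symm a).1
  map_add' _ _ := rfl
  map_smul' _ _ := rfl

/-- The map `X + sZ ↦ ξ^(e)_X - e s`. -/
def extensionMap : CentralExt F →ₗ[ℝ] (Cotangent E G → ℝ) where
  toFun a x := deformedFunction e f (CentralExt.base F a) x - e * CentralExt.coeff F a
  map_add' a b := by
    funext x
    simp only [map_add, deformedFunction_add, Pi.add_apply]
    ring
  map_smul' r a := by
    funext x
    simp only [map_smul, deformedFunction_smul, Pi.smul_apply, smul_eq_mul, RingHom.id_apply]
    ring

theorem extensionMap_mk (X : LieAlg E G) (s : ℝ) (x : Cotangent E G) :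
    extensionMap F e f (CentralExt.mk F X s) x = deformedFunction e f X x - e * s := rfl

theorem extensionMap_injective (he : e ≠ 0) : Function.Injective (extensionMap F e f) := by
  refine (injective_iff_map_eq_zero _).2 fun a ha => ?_
  obtain ⟨X, s, rfl⟩ := CentralExt.exists_eq_mk F a
  have h (x : Cotangent E G) : deformedFunction e f X x = e * s :=
    sub_eq_zero.1 (congrFun ha x)
  obtain rfl := eq_zero_of_deformedFunction_eq_const e f h
  have h0 : deformedFunction e f (0 : LieAlg E G) = 0 := by
    simpa using deformedFunction_smul e f 0 0
  have h1 := h ⟨1, 0⟩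
  rw [h0] at h1
  obtain rfl : s = 0 := (mul_eq_zero.1 h1.symm).resolve_left he
  rfl

theorem range_extensionMap (he : e ≠ 0) :
    LinearMap.range (extensionMap F e f) = integralAlgebra e f := by
  apply le_antisymm
  · rintro _ ⟨a, rfl⟩
    obtain ⟨X, s, rfl⟩ := CentralExt.exists_eq_mk F a
    have h : extensionMap F e f (CentralExt.mk F X s) =
        deformedFunction e f X - (e * s) • fun _ => (1 : ℝ) := by
      funext x
      simp [extensionMap_mk]
    rw [h]
    exact sub_mem (Submodule.subset_span (Or.inl ⟨X, rfl⟩))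
      (Submodule.smul_mem _ _ (Submodule.subset_span (Or.inr rfl)))
  · refine Submodule.span_le.2 ?_
    rintro _ (⟨X, rfl⟩ | rfl)
    · refine ⟨CentralExt.mk F X 0, funext fun x => ?_⟩
      rw [extensionMap_mk, mul_zero, sub_zero]
    -- `Z` maps to the constant `-e`, so the constant `1` comes from `-e⁻¹ Z`. This is where `e ≠ 0`
    -- makes the constants reachable.
    · refine ⟨CentralExt.mk F 0 (-e⁻¹), funext fun x => ?_⟩
      have h0 : deformedFunction e f (0 : LieAlg E G) = 0 := by
        simpa using deformedFunction_smul e f 0 0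
      rw [extensionMap_mk, h0]
      simp [he]

/-- The isomorphism of the central extension with the algebra of integrals. -/
def extensionEquiv (he : e ≠ 0) : CentralExt F ≃ₗ[ℝ] integralAlgebra e f :=
  (LinearEquiv.ofInjective _ (extensionMap_injective F e f he)).trans
    (LinearEquiv.ofEq _ _ (range_extensionMap F e f he))

variable {F} in
/-- The splitting of the central extension by a trivial cocycle. -/
def splitting {μ : Module.Dual ℝ (LieAlg E G)} (hμ : ∀ X Y, F.form X Y = μ ⁅X, Y⁆) :
    LieAlg E G →ₗ⁅ℝ⁆ CentralExt F where
  toFun X := CentralExt.mk F X (μ X)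
  map_add' X Y := by rw [map_add, CentralExt.mk_add]
  map_smul' r X := by
    rw [map_smul, smul_eq_mul, CentralExt.mk_smul]
    rfl
  map_lie' {X Y} := by
    change CentralExt.mk F ⁅X, Y⁆ (μ ⁅X, Y⁆) = ⁅CentralExt.mk F X (μ X), CentralExt.mk F Y (μ Y)⁆
    rw [CentralExt.lie_mk, hμ]

end Algebra

/-! ### Shifted integrals for a trivial cocycle. -/

section Shifted

variable {E : Type*} [NormedAddCommGroup E] [NormedSpace ℝ E]
  {G : Type*} [TopologicalSpace G] [ChartedSpace E G] [Group G]
  (e : ℝ) (f : LieAlg E G →ₗ[ℝ] (G → ℝ)) (μ : Module.Dual ℝ (LieAlg E G))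

/-- The map `X ↦ ξ^(e)_X - e μ(X)`. -/
def shiftedMap : LieAlg E G →ₗ[ℝ] (Cotangent E G → ℝ) where
  toFun X x := deformedFunction e f X x - e * μ X
  map_add' X Y := by
    funext x
    simp only [map_add, deformedFunction_add, Pi.add_apply]
    ring
  map_smul' r X := by
    funext x
    simp only [map_smul, deformedFunction_smul, Pi.smul_apply, smul_eq_mul, RingHom.id_apply]
    ring

theorem shiftedMap_injective : Function.Injective (shiftedMap e f μ) := by
  refine (injective_iff_map_eq_zero _).2 fun X hX => ?_
  exact eq_zero_of_deformedFunction_eq_const e f (r := e * μ X)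
    fun x => sub_eq_zero.1 (congrFun hX x)

theorem range_shiftedMap : LinearMap.range (shiftedMap e f μ) =
    Submodule.span ℝ (Set.range fun (X : LieAlg E G) (x : Cotangent E G) =>
      deformedFunction e f X x - e * μ X) :=
  (Submodule.span_eq (LinearMap.range (shiftedMap e f μ))).symm

/-- The isomorphism of the Lie algebra with the span of the shifted integrals. -/
def shiftedEquiv : LieAlg E G ≃ₗ[ℝ] Submodule.span ℝ
    (Set.range fun (X : LieAlg E G) (x : Cotangent E G) => deformedFunction e f X x - e * μ X) :=
  (LinearEquiv.ofInjective _ (shiftedMap_injective e f μ)).trans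
    (LinearEquiv.ofEq _ _ (range_shiftedMap e f μ))

end Shifted

section Quotient

variable {E : Type*} [NormedAddCommGroup E] [NormedSpace ℝ E]
  {G : Type*} [TopologicalSpace G] [ChartedSpace E G]

theorem derivAlong_smul (U : G → ℝ) (g : G) (r : ℝ) (v : TangentSpace 𝓘(ℝ, E) g) :
    derivAlong U g (r • v) = r * derivAlong U g v :=
  map_smul (mderiv E ℝ U g) r (v : E)

end Quotient

end MagneticFlow

end

/-! ### Assembly of the theorem. -/

theorem mainTheorem3
    {E : Type*} [NormedAddCommGroup E] [NormedSpace ℝ E] [FiniteDimensional ℝ E] [CompleteSpace E]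
    {G : Type*} [TopologicalSpace G] [ChartedSpace E G] [Group G] [LieGroup 𝓘(ℝ, E) ∞ G]
    [ConnectedSpace G]
    {E' : Type*} [NormedAddCommGroup E'] [NormedSpace ℝ E'] [FiniteDimensional ℝ E']
    [CompleteSpace E']
    {G' : Type*} [TopologicalSpace G'] [ChartedSpace E' G'] [Group G'] [LieGroup 𝓘(ℝ, E') ∞ G']
    [ConnectedSpace G']
    (F : Cocycle E G) (ρ : G' →* G) (Φ : CentralExt F ≃ₗ⁅ℝ⁆ LieAlg E' G')
    (h : IsCentralExtension F ρ Φ)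
    (f : LieAlg E G →ₗ[ℝ] (G → ℝ)) (hf : f = potentialCochain F ρ Φ h) (e : ℝ) :
    -- the cochain `f` is smooth and given by `f(Y) = U⁻¹ (ξ̃_Y + η̃_{Ad_g Y}) U |_G`
    (∀ Y, ContMDiff 𝓘(ℝ, E) 𝓘(ℝ, ℝ) ∞ (f Y)) ∧
    (∀ (Y : LieAlg E G) (k : G'),
      leftField (Φ (CentralExt.mk F Y 0)) k + rightField (Φ (CentralExt.mk F (Ad (ρ k) Y) 0)) k =
        -(f Y (ρ k)) • leftField (Φ (CentralExt.mk F 0 1)) k) ∧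
    (∀ (Y : LieAlg E G) (k : G') (V : Set G') (U : G' → ℝ), IsOpen V → k ∈ V →
      ContMDiffOn 𝓘(ℝ, E') 𝓘(ℝ, ℝ) ∞ U V → (∀ l ∈ V, U l ≠ 0) →
      (∀ l ∈ V, derivAlong U l (leftField (Φ (CentralExt.mk F 0 1)) l) = -U l) →
      f Y (ρ k) = (U k)⁻¹ * derivAlong U k
        (leftField (Φ (CentralExt.mk F Y 0)) k +
          rightField (Φ (CentralExt.mk F (Ad (ρ k) Y) 0)) k)) ∧
    -- the functions `ξ^(e)_X` are integrals of the magnetic geodesic flow of every right-invariant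
    -- metric, and so are their linear combinations with constants
    (∀ (B : LinearMap.BilinForm ℝ (LieAlg E G)) (hB : B.Nondegenerate), B.IsSymm →
      (∀ X, IsIntegralOfMotion e F (metricHamiltonian B hB) (deformedFunction e f X)) ∧
      (∀ X, poissonBracket e F (deformedFunction e f X) (metricHamiltonian B hB) = 0) ∧
      (∀ φ ∈ integralAlgebra e f, IsIntegralOfMotion e F (metricHamiltonian B hB) φ)) ∧
    -- the commutation relations
    (∀ (X Y : LieAlg E G) (x : Cotangent E G),
      poissonBracket e F (deformedFunction e f X) (deformedFunction e f Y) x =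
        deformedFunction e f ⁅X, Y⁆ x - e * F.form X Y) ∧
    -- the algebra of integrals is isomorphic to the central extension
    (e ≠ 0 → ∃ Ψ : CentralExt F ≃ₗ[ℝ] integralAlgebra e f,
      (∀ (X : LieAlg E G) (s : ℝ) (x : Cotangent E G),
        (Ψ (CentralExt.mk F X s)).1 x = deformedFunction e f X x - e * s) ∧
      ∀ a b : CentralExt F, poissonBracket e F (Ψ a).1 (Ψ b).1 = (Ψ ⁅a, b⁆).1) ∧
    -- for a trivial cocycle the extension splits, and the shifted integrals form an algebra
    -- isomorphic to the Lie algebra of `G`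
    (∀ μ : Module.Dual ℝ (LieAlg E G), (∀ X Y, F.form X Y = μ ⁅X, Y⁆) →
      (∃ r : LieAlg E G →ₗ⁅ℝ⁆ CentralExt F, ∀ X, r X = CentralExt.mk F X (μ X)) ∧
      ∃ Ψ : LieAlg E G ≃ₗ[ℝ] Submodule.span ℝ (Set.range fun (X : LieAlg E G) (x : Cotangent E G) =>
          deformedFunction e f X x - e * μ X),
        (∀ (X : LieAlg E G) (x : Cotangent E G),
          (Ψ X).1 x = deformedFunction e f X x - e * μ X) ∧
        ∀ X Y : LieAlg E G, poissonBracket e F (Ψ X).1 (Ψ Y).1 = (Ψ ⁅X, Y⁆).1) := by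
  subst hf
  -- Arbitrary constants `s` and `t` are allowed because they drop out of the bracket. One relation
  -- then serves the plain functions, the central extension and the shifted integrals.
  have hcomm (X Y : LieAlg E G) (s t : ℝ) :
      poissonBracket e F (fun x => deformedFunction e (potentialCochain F ρ Φ h) X x - s)
        (fun x => deformedFunction e (potentialCochain F ρ Φ h) Y x - t) =
      fun x => deformedFunction e (potentialCochain F ρ Φ h) ⁅X, Y⁆ x - e * F.form X Y := by
    rw [h.deformedFunction_sub_eq, h.deformedFunction_sub_eq, h.deformedFunction_sub_eq]
    exact h.poissonBracket_integral X Y s t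
  have hfield (Y : LieAlg E G) (k : G') :
      leftField (Φ (CentralExt.mk F Y 0)) k +
          rightField (Φ (CentralExt.mk F (Ad (ρ k) Y) 0)) k =
        -(potentialCochain F ρ Φ h Y (ρ k)) • leftField (Φ (CentralExt.mk F 0 1)) k :=
    h.leftVec_sub_rightVec Y k
  refine ⟨fun Y => h.contMDiff_potentialCochain Y, hfield, ?_, ?_, ?_, ?_, ?_⟩
  · intro Y k V U _ hk _ hU hZ
    rw [hfield, derivAlong_smul, hZ k hk, neg_mul_neg]
    field_simp [hU k hk]
  · intro B hB _
    exact ⟨fun X => h.isIntegralOfMotion B hB (Submodule.subset_span (Or.inl ⟨X, rfl⟩)),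
      fun X => h.deformedFunction_eq e X ▸ h.poissonBracket_integral_metricHamiltonian B hB X 0,
      fun φ hφ => h.isIntegralOfMotion B hB hφ⟩
  · intro X Y x
    simpa using congrFun (hcomm X Y 0 0) x
  · intro he
    refine ⟨extensionEquiv F e _ he, fun X s x => rfl, fun a b => ?_⟩
    obtain ⟨X, s, rfl⟩ := CentralExt.exists_eq_mk F a
    obtain ⟨Y, t, rfl⟩ := CentralExt.exists_eq_mk F b
    rw [CentralExt.lie_mk]
    exact hcomm X Y (e * s) (e * t)
  · intro μ hμ
    refine ⟨⟨splitting hμ, fun X => rfl⟩, shiftedEquiv e _ μ, fun X x => rfl, fun X Y => ?_⟩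
    -- For a trivial cocycle the constant `e F(X, Y)` is exactly the shift `e μ([X, Y])` belonging
    -- to the bracket.
    refine (hcomm X Y (e * μ X) (e * μ Y)).trans ?_
    rw [hμ]
    rfl
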